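/- Let $\chi_5(a)=\left(\frac{a}{5}\right)$ be the Legendre symbol modulo $5$. For $n\ge 0$ put $$p_5(n)=\sum_{\pi}\chi_5(a_1)\cdots\chi_5(a_k),\qquad p_5^{\dagger}(n)=\sum_{\pi}(-1)^k\chi_5(a_1)\cdots\chi_5(a_k),$$ where both sums run over all partitions $\pi=(a_1,\dots,a_k)$ of $n$. Then, for all integers $j\ge 0$, $$p_5^{\dagger}(10j)=p_5(10j)\qquad\text{and}\qquad p_5^{\dagger}(10j+8)=-p_5(10j+8).$$ Equivalently, for complex $q$ with $|q|<1$ write $(z;q)=\prod_{n\ge 0}(1-zq^n)$ and $(z_1,\dots,z_m;q)=(z_1;q)\cdots(z_m;q)$, and let $$X(q)=(q,-q^2,-q^3,q^4;q^5),\qquad Y(q)=(-q,q^2,q^3,-q^4;q^5).$$ These products do not vanish for $|q|<1$, and there $\frac1{X(q)}=\sum_{n\ge0}p_5(n)q^n$ and $\frac1{Y(q)}=\sum_{n\ge0}p_5^{\dagger}(n)q^n$. With the notation $[f]_{[r]}=\sum_{j\ge0}a_{10j+r}q^{10j}$ for $f(q)=\sum_{n\ge0}a_nq^n$, one has $$[1/Y]_{[0]}=[1/X]_{[0]}\qquad\text{and}\qquad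 [1/Y]_{[8]}=-[1/X]_{[8]}\qquad(|q|<1).$$ -/

import Mathlib

namespace LegendreSigned

instance fact_prime_five : Fact (Nat.Prime 5) := ⟨by norm_num⟩

/-- The Legendre symbol `(n / 5)`. -/
def chi5 (n : ℕ) : ℤ := legendreSym 5 (n : ℤ)

/-- The sign of a partition: the product of `chi5 a` over its parts `a`, with multiplicity. -/
def chi5Partition {n : ℕ} (π : n.Partition) : ℤ := (π.parts.map chi5).prod

/-- The sign attached to `-chi5`: the factor `(-1) ^ k`, where `k` is the number of parts, times
the product of `chi5 a` over the parts `a`. -/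
def negChi5Partition {n : ℕ} (π : n.Partition) : ℤ :=
  (-1) ^ Multiset.card π.parts * (π.parts.map chi5).prod

/-- The Legendre-signed partition numbers. -/
def p5 (n : ℕ) : ℤ := ∑ π : n.Partition, chi5Partition π

/-- The partition numbers signed by `-chi5`. -/
def p5dag (n : ℕ) : ℤ := ∑ π : n.Partition, negChi5Partition π

/-- The infinite product `(z; q)`, that is, the product of `1 - z q ^ n` over `n ≥ 0`. -/
noncomputable def qPoch (z q : ℂ) : ℂ := ∏' n : ℕ, (1 - z * q ^ n)

/-- `X(q) = (q, -q^2, -q^3, q^4; q^5)`. -/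
noncomputable def X (q : ℂ) : ℂ :=
  qPoch q (q ^ 5) * qPoch (-q ^ 2) (q ^ 5) * qPoch (-q ^ 3) (q ^ 5) * qPoch (q ^ 4) (q ^ 5)

/-- `Y(q) = (-q, q^2, q^3, -q^4; q^5)`. -/
noncomputable def Y (q : ℂ) : ℂ :=
  qPoch (-q) (q ^ 5) * qPoch (q ^ 2) (q ^ 5) * qPoch (q ^ 3) (q ^ 5) * qPoch (-q ^ 4) (q ^ 5)

/-- The coefficient of `q ^ n` in the power series expansion at `0` of a function that is
holomorphic in the open unit disc. -/
noncomputable def qCoeff (f : ℂ → ℂ) (n : ℕ) : ℂ := iteratedDeriv n f 0 / (n.factorial : ℂ)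

/-- The component of type 10 and index `r` of `f(q) = ∑ a_n q ^ n`, that is, the function
`q ↦ ∑ a_{10 j + r} q ^ (10 j)`, the sum being over `j ≥ 0`. -/
noncomputable def component (f : ℂ → ℂ) (r : ℕ) (q : ℂ) : ℂ :=
  ∑' j : ℕ, qCoeff f (10 * j + r) * q ^ (10 * j)

end LegendreSigned

open Filter Topology Finset

namespace LegendreSigned

/-! Since X Y is an explicit product, 1/X ± 1/Y = (Y ± X)/(X Y) is known once Y ± X factors. Up to
the factor (q^5; q^5)^2, both X and Y are products of two theta functions. Expanding these by the
triple product and splitting the index pairs by parity factors the sum and the difference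
(`theta_mul_theta_neg_add`, `theta_neg_mul_theta_sub`). The resulting theta quotients are those of
Kronecker's formula `tsum_kronecker`, whence, for 0 < |q| < 1 and sums over all integers k, (1/X +
1/Y) (q^10; q^10)^2 = 2 ∑ q^(5k) / (1 - q^(10k+2)), (1/X - 1/Y) (q^10; q^10)^2 = 2q ∑ q^(5k) / (1 -
q^(10k+4)).

The factor (q^10; q^10)^2 is a series in q^10 and does not mix residue classes modulo 10. So it
suffices that the first Lambert series has no exponents congruent to 8, and the second none
congruent to 9. Put c = 2 or c = 4. Geometric expansion of the terms with k ≥ 0 gives +q^e for every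
factorization e + c/2 = (5n + c/2)(2l + 1), and the terms with k < 0 give -q^e for every e + c/2 =
(5n + 5 - c/2)(2l + 1). In the class concerned e + c/2 is odd, which forces the two factors to be 1
and 9 modulo 10 (c = 2), or 7 and 3 (c = 4). Exchanging the factors pairs positive terms with
negative ones, and everything cancels (`rootSum_lambert_two`, `rootSum_lambert_four`).

The generating functions `hasSum_p5` and `hasSum_p5dag` carry this over to the partition numbers. -/

/-! ### Finite and infinite q-products -/

/-- The finite product `(z; q)_n`. -/
noncomputable def qPochFin (z q : ℂ) (n : ℕ) : ℂ := ∏ i ∈ range n, (1 - z * q ^ i)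

lemma qPochFin_succ (z q : ℂ) (n : ℕ) :
    qPochFin z q (n + 1) = qPochFin z q n * (1 - z * q ^ n) := prod_range_succ _ _

lemma qPochFin_add (z q : ℂ) (m n : ℕ) :
    qPochFin z q (m + n) = qPochFin z q m * qPochFin (z * q ^ m) q n := by
  simp only [qPochFin, prod_range_add, pow_add, mul_assoc]

lemma qPochFin_ne_zero {z q : ℂ} (h : ∀ i, z * q ^ i ≠ 1) (n : ℕ) : qPochFin z q n ≠ 0 :=
  prod_ne_zero_iff.2 fun i _ => sub_ne_zero.2 (h i).symm

lemma summable_norm_mul_pow (z : ℂ) {q : ℂ} (hq : ‖q‖ < 1) :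
    Summable fun n : ℕ => ‖-(z * q ^ n)‖ := by
  simp only [norm_neg, norm_mul, norm_pow]
  exact (summable_geometric_of_lt_one (norm_nonneg q) hq).mul_left _

lemma tendsto_qPochFin (z : ℂ) {q : ℂ} (hq : ‖q‖ < 1) :
    Tendsto (qPochFin z q) atTop (𝓝 (qPoch z q)) := by
  have h := (multipliable_one_add_of_summable (summable_norm_mul_pow z hq)).hasProd.tendsto_prod_nat
  simp only [← sub_eq_add_neg] at h
  exact h

lemma qPoch_ne_zero {z q : ℂ} (hq : ‖q‖ < 1) (h : ∀ i : ℕ, z * q ^ i ≠ 1) : qPoch z q ≠ 0 := by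
  have := tprod_one_add_ne_zero_of_summable (f := fun n : ℕ => -(z * q ^ n))
    (fun i => by rw [← sub_eq_add_neg]; exact sub_ne_zero.2 (h i).symm) (summable_norm_mul_pow z hq)
  simp only [← sub_eq_add_neg] at this
  exact this

lemma mul_pow_ne_one {z q : ℂ} (hq : ‖q‖ < 1) (hz : ‖z‖ < 1) (i : ℕ) : z * q ^ i ≠ 1 := by
  intro h
  have h1 : ‖z‖ * ‖q‖ ^ i = 1 := by simpa using congrArg norm h
  have h2 : ‖q‖ ^ i ≤ 1 := pow_le_one₀ (norm_nonneg _) hq.le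
  nlinarith [norm_nonneg z]

lemma qPoch_ne_zero_of_norm_lt {z q : ℂ} (hq : ‖q‖ < 1) (hz : ‖z‖ < 1) : qPoch z q ≠ 0 :=
  qPoch_ne_zero hq (mul_pow_ne_one hq hz)

lemma norm_pow_lt_one {q : ℂ} (hq : ‖q‖ < 1) {n : ℕ} (hn : n ≠ 0) : ‖q ^ n‖ < 1 := by
  rw [norm_pow]; exact pow_lt_one₀ (norm_nonneg _) hq hn

lemma qPoch_mul_qPoch_neg (z : ℂ) {q : ℂ} (hq : ‖q‖ < 1) :
    qPoch z q * qPoch (-z) q = qPoch (z ^ 2) (q ^ 2) := by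
  refine tendsto_nhds_unique ((tendsto_qPochFin z hq).mul (tendsto_qPochFin (-z) hq)) ?_
  convert tendsto_qPochFin (z ^ 2) (norm_pow_lt_one hq two_ne_zero) using 2 with n
  simp only [qPochFin, ← prod_mul_distrib]
  exact prod_congr rfl fun i _ => by ring

lemma qPoch_eq_even_mul_odd (z : ℂ) {q : ℂ} (hq : ‖q‖ < 1) :
    qPoch z q = qPoch z (q ^ 2) * qPoch (z * q) (q ^ 2) := by
  have hq2 := norm_pow_lt_one hq two_ne_zero
  refine tendsto_nhds_unique ((tendsto_qPochFin z hq).comp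
    (tendsto_id.const_mul_atTop' two_pos)) ?_
  convert (tendsto_qPochFin z hq2).mul (tendsto_qPochFin (z * q) hq2) using 2 with n
  simp only [Function.comp, id]
  induction n with
  | zero => simp [qPochFin]
  | succ n ih =>
    rw [show 2 * (n + 1) = 2 * n + 1 + 1 by ring, qPochFin_succ, qPochFin_succ, ih, qPochFin_succ, qPochFin_succ]
    ring

lemma exists_norm_qPochFin_le (z : ℂ) {q : ℂ} (hq : ‖q‖ < 1) :
    ∃ C, ∀ n, ‖qPochFin z q n‖ ≤ C := by
  obtain ⟨C, hC⟩ := (tendsto_qPochFin z hq).norm.bddAbove_range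
  exact ⟨C, fun n => hC ⟨n, rfl⟩⟩

lemma exists_norm_inv_qPochFin_le {z q : ℂ} (hq : ‖q‖ < 1) (h : ∀ i : ℕ, z * q ^ i ≠ 1) :
    ∃ C, ∀ n, ‖(qPochFin z q n)⁻¹‖ ≤ C := by
  obtain ⟨C, hC⟩ := ((tendsto_qPochFin z hq).inv₀ (qPoch_ne_zero hq h)).norm.bddAbove_range
  exact ⟨C, fun n => hC ⟨n, rfl⟩⟩

/-- Reversal of `(a q⁻ⁿ; q)_n`. -/
lemma qPochFin_shift {a q : ℂ} (ha : a ≠ 0) (hq : q ≠ 0) (n : ℕ) :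
    qPochFin (a * (q ^ n)⁻¹) q n = (∏ i ∈ range n, -(a * (q ^ (i + 1))⁻¹)) * qPochFin (q / a) q n := by
  rw [qPochFin, qPochFin, ← prod_mul_distrib, ← prod_range_reflect]
  refine prod_congr rfl fun i hi => ?_
  obtain ⟨d, rfl⟩ := Nat.exists_eq_add_of_lt (mem_range.1 hi)
  rw [show i + d + 1 - 1 - i = d by omega]
  field_simp
  ring

/-! ### Limits of symmetric sums -/

/-- Dominated convergence for symmetric partial sums over the integers. -/
lemma tendsto_sum_range_two_mul {g : ℕ → ℕ → ℂ} {h : ℤ → ℂ} {bound : ℤ → ℝ}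
    (hb : Summable bound) (hle : ∀ n j, j ≤ 2 * n → ‖g n j‖ ≤ bound (j - n))
    (hlim : ∀ k : ℤ, Tendsto (fun n : ℕ => g n (n + k).toNat) atTop (𝓝 (h k))) :
    Tendsto (fun n => ∑ j ∈ range (2 * n + 1), g n j) atTop (𝓝 (∑' k, h k)) := by
  classical
  -- The n-th sum is recentred at n and extended by zero to all integers, so that the dominated
  -- convergence theorem for series applies.
  let F : ℕ → ℤ → ℂ := fun n k => if k ∈ Finset.Icc (-n : ℤ) n then g n (n + k).toNat else 0
  have hF : ∀ n, ∑' k, F n k = ∑ j ∈ range (2 * n + 1), g n j := by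
    intro n
    rw [tsum_eq_sum (s := Finset.Icc (-n : ℤ) n) (fun k hk => if_neg hk)]
    refine Finset.sum_nbij' (fun k => (n + k).toNat) (fun j => (j : ℤ) - n) ?_ ?_ ?_ ?_ ?_
    · intro k hk; simp only [Finset.mem_Icc, Finset.mem_range] at *; omega
    · intro k hk; simp only [Finset.mem_Icc, Finset.mem_range] at *; omega
    · intro k hk; simp only [Finset.mem_Icc] at *; omega
    · intro k hk; simp only [Finset.mem_range] at *; omega
    · intro k hk; exact if_pos hk
  simp only [← hF]
  -- Every integer k occurs as j - n with n = |k|, so `bound k` dominates some norm.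
  have hb0 : ∀ k, 0 ≤ bound k := fun k => by
    refine (norm_nonneg _).trans ((hle k.natAbs (k.natAbs + k).toNat (by omega)).trans_eq ?_)
    congr 1
    omega
  refine tendsto_tsum_of_dominated_convergence hb (fun k => ?_) (Eventually.of_forall fun n k => ?_)
  · refine (hlim k).congr' ?_
    filter_upwards [eventually_ge_atTop k.natAbs] with n hn
    exact (if_pos (by simp only [Finset.mem_Icc]; omega)).symm
  · by_cases hk : k ∈ Finset.Icc (-n : ℤ) n
    · simp only [F, if_pos hk]
      simp only [Finset.mem_Icc] at hk
      refine (hle n _ (by omega)).trans_eq ?_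
      congr 1
      omega
    · simp only [F, if_neg hk, norm_zero, hb0]

lemma tendsto_toNat_add (k : ℤ) : Tendsto (fun n : ℕ => (n + k).toNat) atTop atTop :=
  tendsto_atTop.2 fun b => by
    filter_upwards [eventually_ge_atTop (b + k.natAbs)] with n hn
    omega

lemma tendsto_two_mul_sub_toNat_add (k : ℤ) :
    Tendsto (fun n : ℕ => 2 * n - (n + k).toNat) atTop atTop :=
  tendsto_atTop.2 fun b => by
    filter_upwards [eventually_ge_atTop (b + k.natAbs)] with n hn
    omega

/-! ### Kronecker's formula by partial fractions -/

lemma prod_range_erase (f : ℕ → ℂ) (m d : ℕ) :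
    ∏ i ∈ (range (m + d + 1)).erase m, f i =
      (∏ i ∈ range m, f i) * ∏ i ∈ range d, f (m + 1 + i) := by
  induction d with
  | zero => simp [range_add_one]
  | succ d ih =>
    rw [range_add_one, erase_insert_of_ne (by omega), prod_insert (by simp), ← add_assoc, ih,
      prod_range_succ _ d, show m + 1 + d = m + d + 1 by ring]
    ring

/-- The coefficients of the partial fraction expansion of `(b x; q)_N / (b; q)_{N + 1}`. -/
noncomputable def fracCoeff (x q : ℂ) (N j : ℕ) : ℂ :=
  x ^ j * (qPochFin x q (N - j) * qPochFin (q / x) q j /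
    (qPochFin q q (N - j) * qPochFin q q j))

/-- This is the interpolation condition at b = q^(-m) that determines the coefficients. The factors
with i < m carry negative powers of q and are reversed by `qPochFin_shift`; those with i > m form
(q; q)_(N-m). -/
lemma fracCoeff_mul_prod {x q : ℂ} (hx : x ≠ 0) (hq : q ≠ 0) (hq1 : ∀ i : ℕ, q * q ^ i ≠ 1)
    {N m : ℕ} (hm : m ≤ N) :
    fracCoeff x q N m * ∏ i ∈ (range (N + 1)).erase m, (1 - (q ^ m)⁻¹ * q ^ i) =
      qPochFin (x * (q ^ m)⁻¹) q N := by
  obtain ⟨d, rfl⟩ := Nat.exists_eq_add_of_le hm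
  rw [prod_range_erase, qPochFin_add, qPochFin_shift hx hq]
  have h1 : ∏ i ∈ range m, (1 - (q ^ m)⁻¹ * q ^ i) =
      (∏ i ∈ range m, -((q ^ (i + 1))⁻¹)) * qPochFin q q m := by
    simpa [qPochFin] using qPochFin_shift (a := 1) one_ne_zero hq m
  have h2 : ∏ i ∈ range d, (1 - (q ^ m)⁻¹ * q ^ (m + 1 + i)) = qPochFin q q d := by
    refine prod_congr rfl fun i _ => ?_
    field_simp
    ring
  have h3 : ∏ i ∈ range m, -(x * (q ^ (i + 1))⁻¹) =
      x ^ m * ∏ i ∈ range m, -((q ^ (i + 1))⁻¹) := by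
    rw [← card_range m, ← prod_const, card_range, ← prod_mul_distrib]
    exact prod_congr rfl fun i _ => by ring
  rw [h1, h2, h3, fracCoeff, Nat.add_sub_cancel_left, mul_assoc x, inv_mul_cancel₀ (by positivity),
    mul_one]
  have h4 := qPochFin_ne_zero hq1 m
  have h5 := qPochFin_ne_zero hq1 d
  field_simp

-- Both sides are polynomials in b of degree at most N, and they agree at the N + 1 distinct points
-- q^(-m), where only the term j = m survives.
open Polynomial in
lemma sum_fracCoeff_mul_prod {x q : ℂ} (hx : x ≠ 0) (hq : q ≠ 0) (hq1 : ∀ i : ℕ, q * q ^ i ≠ 1)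
    (N : ℕ) (b : ℂ) :
    ∑ j ∈ range (N + 1), fracCoeff x q N j * ∏ i ∈ (range (N + 1)).erase j, (1 - b * q ^ i) =
      qPochFin (b * x) q N := by
  have hdeg : ∀ (s : Finset ℕ) (f : ℕ → ℂ),
      (∏ i ∈ s, (1 - Polynomial.X * C (f i))).degree ≤ (s.card : WithBot ℕ) := by
    intro s f
    refine (degree_prod_le _ _).trans ?_
    refine (sum_le_card_nsmul s _ 1 fun i _ => ?_).trans_eq (by simp)
    compute_degree
  let P : ℂ[X] := ∑ j ∈ range (N + 1), C (fracCoeff x q N j) *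
    ∏ i ∈ (range (N + 1)).erase j, (1 - Polynomial.X * C (q ^ i))
  let R : ℂ[X] := ∏ i ∈ range N, (1 - Polynomial.X * C (x * q ^ i))
  have hP : P.degree < ((range (N + 1)).card : WithBot ℕ) := by
    rw [card_range]
    refine (degree_sum_le _ _).trans_lt ((Finset.sup_lt_iff (WithBot.bot_lt_coe _)).2 fun j hj => ?_)
    refine (degree_mul_le _ _).trans_lt ?_
    have h1 := hdeg ((range (N + 1)).erase j) (fun i => q ^ i)
    rw [card_erase_of_mem hj, card_range, Nat.add_sub_cancel] at h1
    calc _ ≤ (0 : WithBot ℕ) + (N : WithBot ℕ) := add_le_add degree_C_le h1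
      _ = (N : WithBot ℕ) := zero_add _
      _ < _ := by exact_mod_cast Nat.lt_succ_self N
  have hR : R.degree < ((range (N + 1)).card : WithBot ℕ) := by
    refine (hdeg (range N) fun i => x * q ^ i).trans_lt ?_
    rw [card_range, card_range]
    exact_mod_cast Nat.lt_succ_self N
  have hinj : ∀ i j : ℕ, i < j → q ^ i ≠ q ^ j := by
    intro i j hij h
    obtain ⟨d, rfl⟩ := Nat.exists_eq_add_of_lt hij
    refine hq1 d (mul_left_cancel₀ (pow_ne_zero i hq) ?_)
    rw [mul_one]
    exact (by ring : _ = q ^ (i + d + 1)).trans h.symm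
  have hPR : P = R := by
    refine eq_of_degrees_lt_of_eval_index_eq (v := fun m : ℕ => (q ^ m)⁻¹) (range (N + 1)) ?_ hP hR ?_
    · intro i _ j _ hij
      have hij : q ^ i = q ^ j := inv_injective hij
      rcases lt_trichotomy i j with h | h | h
      · exact absurd hij (hinj i j h)
      · exact h
      · exact absurd hij.symm (hinj j i h)
    · intro m hm
      simp only [P, R, eval_finsetSum, eval_mul, eval_prod, eval_sub, eval_one, eval_C, eval_X]
      rw [sum_eq_single_of_mem m hm]
      · rw [fracCoeff_mul_prod hx hq hq1 (Nat.lt_succ_iff.1 (mem_range.1 hm))]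
        exact prod_congr rfl fun i _ => by ring
      · intro j hj hjm
        rw [prod_eq_zero (mem_erase.2 ⟨hjm.symm, hm⟩), mul_zero]
        rw [inv_mul_cancel₀ (pow_ne_zero m hq), sub_self]
  have := congrArg (Polynomial.eval b) hPR
  simp only [P, R, eval_finsetSum, eval_mul, eval_prod, eval_sub, eval_one, eval_C, eval_X] at this
  rw [this, qPochFin]
  exact prod_congr rfl fun i _ => by ring

lemma sum_fracCoeff_div {x q b : ℂ} (hx : x ≠ 0) (hq : q ≠ 0) (hq1 : ∀ i : ℕ, q * q ^ i ≠ 1)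
    (hb : ∀ i : ℕ, b * q ^ i ≠ 1) (N : ℕ) :
    ∑ j ∈ range (N + 1), fracCoeff x q N j / (1 - b * q ^ j) =
      qPochFin (b * x) q N / qPochFin b q (N + 1) := by
  rw [← sum_fracCoeff_mul_prod hx hq hq1, sum_div]
  refine sum_congr rfl fun j hj => ?_
  have h1 : qPochFin b q (N + 1) =
      (1 - b * q ^ j) * ∏ i ∈ (range (N + 1)).erase j, (1 - b * q ^ i) :=
    (mul_prod_erase _ _ hj).symm
  have h2 : ∏ i ∈ (range (N + 1)).erase j, (1 - b * q ^ i) ≠ 0 :=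
    prod_ne_zero_iff.2 fun i _ => sub_ne_zero.2 (hb i).symm
  have h3 : 1 - b * q ^ j ≠ 0 := sub_ne_zero.2 (hb j).symm
  rw [h1]
  field_simp

/-- The theta product `(z, q / z, q; q)`. -/
noncomputable def theta (z q : ℂ) : ℂ := qPoch z q * qPoch (q / z) q * qPoch q q

lemma theta_div (z : ℂ) {q : ℂ} (hq : q ≠ 0) : theta (q / z) q = theta z q := by
  rw [theta, theta, div_div_cancel₀ hq, mul_comm (qPoch (q / z) q)]

lemma mul_zpow_ne_one_left {a q : ℂ} (h : ∀ k : ℤ, a * q ^ k ≠ 1) (i : ℕ) : a * q ^ i ≠ 1 := by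
  exact_mod_cast h i

lemma mul_zpow_ne_one_right {a q : ℂ} (ha : a ≠ 0) (hq : q ≠ 0) (h : ∀ k : ℤ, a * q ^ k ≠ 1)
    (i : ℕ) : q / a * q ^ i ≠ 1 := by
  intro h1
  apply h (-(i + 1 : ℕ))
  rw [zpow_neg, zpow_natCast, pow_succ]
  have : q * q ^ i = a := by field_simp at h1; exact h1
  rw [← this]
  field_simp

lemma theta_ne_zero {a q : ℂ} (ha : a ≠ 0) (hq : q ≠ 0) (hq1 : ‖q‖ < 1)
    (h : ∀ k : ℤ, a * q ^ k ≠ 1) : theta a q ≠ 0 :=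
  mul_ne_zero (mul_ne_zero (qPoch_ne_zero hq1 (mul_zpow_ne_one_left h))
    (qPoch_ne_zero hq1 (mul_zpow_ne_one_right ha hq h))) (qPoch_ne_zero_of_norm_lt hq1 hq1)

/-- The annulus |q| < |x| < 1 is what makes both tails geometric: ratio x forwards, ratio q/x
backwards. -/
lemma summable_kronecker {a x q : ℂ} (ha : a ≠ 0) (hq : q ≠ 0) (hq1 : ‖q‖ < 1)
    (hx : ‖x‖ < 1) (hxq : ‖q‖ < ‖x‖) :
    Summable fun k : ℤ => ‖x ^ k / (1 - a * q ^ k)‖ := by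
  have hx0 : x ≠ 0 := norm_pos_iff.1 ((norm_nonneg q).trans_lt hxq)
  have hlim : Tendsto (fun n : ℕ => q ^ n) atTop (𝓝 0) := tendsto_pow_atTop_nhds_zero_of_norm_lt_one hq1
  refine Summable.of_nat_of_neg_add_one ?_ ?_
  · have h1 : Tendsto (fun n : ℕ => ‖(1 - a * q ^ n)⁻¹‖) atTop (𝓝 ‖(1 - a * 0)⁻¹‖) :=
      (((hlim.const_mul a).const_sub 1).inv₀ (by simp)).norm
    obtain ⟨C, hC⟩ := h1.bddAbove_range
    refine Summable.of_nonneg_of_le (fun _ => norm_nonneg _) (fun n => ?_)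
      ((summable_geometric_of_lt_one (norm_nonneg x) hx).mul_right C)
    rw [zpow_natCast, zpow_natCast, div_eq_mul_inv, norm_mul, norm_pow]
    exact mul_le_mul_of_nonneg_left (hC ⟨n, rfl⟩) (by positivity)
  · have h1 : Tendsto (fun n : ℕ => ‖(q ^ (n + 1) - a)⁻¹‖) atTop (𝓝 ‖(0 - a)⁻¹‖) :=
      (((hlim.comp (tendsto_add_atTop_nat 1)).sub_const a).inv₀ (by simpa using ha)).norm
    obtain ⟨C, hC⟩ := h1.bddAbove_range
    have hr : ‖q‖ / ‖x‖ < 1 := (div_lt_one (norm_pos_iff.2 hx0)).2 hxq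
    refine Summable.of_nonneg_of_le (fun _ => norm_nonneg _) (fun n => ?_)
      (((summable_nat_add_iff 1).2 (summable_geometric_of_lt_one (by positivity) hr)).mul_right C)
    have h2 : x ^ (-((n : ℤ) + 1)) / (1 - a * q ^ (-((n : ℤ) + 1))) =
        (q / x) ^ (n + 1) * (q ^ (n + 1) - a)⁻¹ := by
      rw [show -((n : ℤ) + 1) = -((n + 1 : ℕ) : ℤ) by push_cast; ring, zpow_neg, zpow_neg,
        zpow_natCast, zpow_natCast, div_pow, div_eq_mul_inv,
        show 1 - a * (q ^ (n + 1))⁻¹ = (q ^ (n + 1) - a) * (q ^ (n + 1))⁻¹ by field_simp,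
        mul_inv, inv_inv]
      ring
    rw [h2, norm_mul, norm_pow, norm_div]
    exact mul_le_mul_of_nonneg_left (hC ⟨n, rfl⟩) (by positivity)

/-- Kronecker's formula, a case of Ramanujan's `₁ψ₁` summation. -/
theorem tsum_kronecker {a x q : ℂ} (ha : a ≠ 0) (hq : q ≠ 0) (hq1 : ‖q‖ < 1)
    (hx : ‖x‖ < 1) (hxq : ‖q‖ < ‖x‖) (haq : ∀ k : ℤ, a * q ^ k ≠ 1) :
    (∑' k : ℤ, x ^ k / (1 - a * q ^ k)) * (theta a q * theta x q) =
      qPoch q q ^ 3 * theta (a * x) q := by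
  have hx0 : x ≠ 0 := norm_pos_iff.1 ((norm_nonneg q).trans_lt hxq)
  have hqq := mul_pow_ne_one hq1 hq1
  have hE : qPoch q q ≠ 0 := qPoch_ne_zero_of_norm_lt hq1 hq1
  have hal := mul_zpow_ne_one_left haq
  have har := mul_zpow_ne_one_right ha hq haq
  have hA := qPoch_ne_zero hq1 hal
  have hA' := qPoch_ne_zero hq1 har
  have hbn : ∀ n i : ℕ, a * (q ^ n)⁻¹ * q ^ i ≠ 1 := by
    intro n i
    convert haq (i - n) using 1
    rw [zpow_sub₀ hq, zpow_natCast, zpow_natCast]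
    ring
  -- The partial fraction identity with N = 2n and b = a q^(-n): the poles become symmetric about
  -- index 0, and x^(-n) recentres the powers of x.
  have hfin : ∀ n : ℕ, ∑ j ∈ range (2 * n + 1),
      (x ^ n)⁻¹ * (fracCoeff x q (2 * n) j / (1 - a * (q ^ n)⁻¹ * q ^ j)) =
      qPochFin (q / (a * x)) q n * qPochFin (a * x) q n /
        (qPochFin (q / a) q n * qPochFin a q (n + 1)) := by
    intro n
    rw [← mul_sum, sum_fracCoeff_div hx0 hq hqq (hbn n), two_mul, add_assoc,
      qPochFin_add _ _ n n, qPochFin_add _ _ n (n + 1),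
      show a * (q ^ n)⁻¹ * x = a * x * (q ^ n)⁻¹ by ring, qPochFin_shift (mul_ne_zero ha hx0) hq,
      qPochFin_shift ha hq, inv_mul_cancel_right₀ (pow_ne_zero n hq),
      inv_mul_cancel_right₀ (pow_ne_zero n hq)]
    have h1 : ∏ i ∈ range n, -(a * x * (q ^ (i + 1))⁻¹) =
        x ^ n * ∏ i ∈ range n, -(a * (q ^ (i + 1))⁻¹) := by
      nth_rw 2 [← card_range n]
      rw [← prod_const, ← prod_mul_distrib]
      exact prod_congr rfl fun i _ => by ring
    have h2 : ∏ i ∈ range n, -(a * (q ^ (i + 1))⁻¹) ≠ 0 :=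
      prod_ne_zero_iff.2 fun i _ => neg_ne_zero.2 (mul_ne_zero ha (inv_ne_zero (pow_ne_zero _ hq)))
    have h3 := qPochFin_ne_zero har n
    have h4 := qPochFin_ne_zero hal (n + 1)
    rw [h1]
    generalize ∏ i ∈ range n, -(a * (q ^ (i + 1))⁻¹) = T at h2
    field_simp
  obtain ⟨C₁, hC₁⟩ := exists_norm_qPochFin_le x hq1
  obtain ⟨C₂, hC₂⟩ := exists_norm_qPochFin_le (q / x) hq1
  obtain ⟨C₃, hC₃⟩ := exists_norm_inv_qPochFin_le hq1 hqq
  have hC1 := (norm_nonneg _).trans (hC₁ 0)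
  have hC2 := (norm_nonneg _).trans (hC₂ 0)
  have hC3 := (norm_nonneg _).trans (hC₃ 0)
  have hterm : ∀ n j : ℕ, (x ^ n)⁻¹ * (fracCoeff x q (2 * n) j / (1 - a * (q ^ n)⁻¹ * q ^ j)) =
      x ^ ((j : ℤ) - n) / (1 - a * q ^ ((j : ℤ) - n)) *
      (qPochFin x q (2 * n - j) * qPochFin (q / x) q j *
        ((qPochFin q q (2 * n - j))⁻¹ * (qPochFin q q j)⁻¹)) := by
    intro n j
    rw [fracCoeff, zpow_sub₀ hx0, zpow_sub₀ hq, zpow_natCast, zpow_natCast, zpow_natCast,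
      zpow_natCast, ← mul_inv, show a * (q ^ j / q ^ n) = a * (q ^ n)⁻¹ * q ^ j by ring]
    ring
  have hlim := tendsto_sum_range_two_mul
    (g := fun n j => (x ^ n)⁻¹ * (fracCoeff x q (2 * n) j / (1 - a * (q ^ n)⁻¹ * q ^ j)))
    (h := fun k => x ^ k / (1 - a * q ^ k) * (qPoch x q * qPoch (q / x) q *
      ((qPoch q q)⁻¹ * (qPoch q q)⁻¹)))
    (bound := fun k => ‖x ^ k / (1 - a * q ^ k)‖ * (C₁ * C₂ * (C₃ * C₃)))
    ((summable_kronecker ha hq hq1 hx hxq).mul_right _)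
    (fun n j _ => by
      simp only [hterm]
      rw [norm_mul, norm_mul _ (_ * _), norm_mul _ (qPochFin (q / x) q j), norm_mul _ (_)⁻¹]
      gcongr
      exacts [hC₁ _, hC₂ _, hC₃ _, hC₃ _])
    (fun k => by
      simp only [hterm]
      refine Tendsto.mul (tendsto_const_nhds.congr' ?_) ?_
      · filter_upwards [eventually_ge_atTop k.natAbs] with n hn
        rw [show (((n + k).toNat : ℕ) : ℤ) - n = k by omega]
      · have h1 := tendsto_toNat_add k
        have h2 := tendsto_two_mul_sub_toNat_add k
        exact (((tendsto_qPochFin x hq1).comp h2).mul ((tendsto_qPochFin _ hq1).comp h1)).mul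
          ((((tendsto_qPochFin q hq1).comp h2).inv₀ hE).mul
            (((tendsto_qPochFin q hq1).comp h1).inv₀ hE)))
  simp only [hfin] at hlim
  have hlim' : Tendsto (fun n : ℕ => qPochFin (q / (a * x)) q n * qPochFin (a * x) q n /
        (qPochFin (q / a) q n * qPochFin a q (n + 1))) atTop
      (𝓝 (qPoch (q / (a * x)) q * qPoch (a * x) q / (qPoch (q / a) q * qPoch a q))) :=
    ((tendsto_qPochFin _ hq1).mul (tendsto_qPochFin _ hq1)).div
      ((tendsto_qPochFin _ hq1).mul ((tendsto_qPochFin _ hq1).comp (tendsto_add_atTop_nat 1)))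
      (mul_ne_zero hA' hA)
  have := tendsto_nhds_unique hlim hlim'
  rw [tsum_mul_right] at this
  simp only [theta]
  field_simp at this
  linear_combination (qPoch q q) ^ 2 * this

/-! ### The Jacobi triple product -/

/-- The Gaussian binomial coefficient. -/
noncomputable def gaussBinom (q : ℂ) (N j : ℕ) : ℂ :=
  qPochFin q q N / (qPochFin q q (N - j) * qPochFin q q j)

lemma two_mul_triangle (k : ℤ) : 2 * (k * (k - 1) / 2) = k * (k - 1) :=
  Int.two_mul_ediv_two_of_even (Int.even_mul_pred_self k)

lemma triangle_succ (k : ℤ) : (k + 1) * (k + 1 - 1) / 2 = k * (k - 1) / 2 + k := by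
  have h1 := two_mul_triangle k
  have h2 := two_mul_triangle (k + 1)
  linarith

/-- The terms of the theta series. -/
noncomputable def thetaTerm (z q : ℂ) (k : ℤ) : ℂ := (-1) ^ k * q ^ (k * (k - 1) / 2) * z ^ k

lemma thetaTerm_succ {z q : ℂ} (hz : z ≠ 0) (hq : q ≠ 0) (k : ℤ) :
    thetaTerm z q (k + 1) = -(z * q ^ k) * thetaTerm z q k := by
  rw [thetaTerm, thetaTerm, triangle_succ, zpow_add₀ hq, zpow_add_one₀ hz,
    zpow_add_one₀ (by norm_num)]
  ring

lemma thetaTerm_neg (z q : ℂ) (k : ℤ) : thetaTerm (-z) q k = (-1) ^ k * thetaTerm z q k := by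
  rw [thetaTerm, thetaTerm, neg_eq_neg_one_mul z, mul_zpow]
  ring

/-- The finite `q`-binomial theorem. -/
lemma qPochFin_eq_sum {z q : ℂ} (hz : z ≠ 0) (hq : q ≠ 0) (hq1 : ∀ i : ℕ, q * q ^ i ≠ 1) (N : ℕ) :
    qPochFin z q N = ∑ j ∈ range (N + 1), gaussBinom q N j * thetaTerm z q j := by
  have hne := qPochFin_ne_zero hq1
  have hq0 : qPochFin q q 0 = 1 := by simp [qPochFin]
  induction N with
  | zero => simp [qPochFin, gaussBinom, thetaTerm]
  | succ N ih =>
    -- The q-Pascal rule [N+1, j] = [N, j] + q^(N+1-j) [N, j-1]. The guard j ≤ N is needed because,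
    -- with truncated subtraction, `gaussBinom q N (N + 1)` is not zero.
    have hpt : ∀ j ∈ range (N + 1 + 1), gaussBinom q (N + 1) j * thetaTerm z q j =
        (if j ≤ N then gaussBinom q N j * thetaTerm z q j else 0) +
        (if 0 < j then -(z * q ^ N) * (gaussBinom q N (j - 1) * thetaTerm z q ((j - 1 : ℕ) : ℤ))
          else 0) := by
      intro j hj
      rw [mem_range] at hj
      rcases j with _ | i
      · have h1 := hne (N + 1)
        have h2 := hne N
        simp [gaussBinom, h1, h2, hq0]
      · have hi : thetaTerm z q ((i + 1 : ℕ) : ℤ) = -(z * q ^ i) * thetaTerm z q i := by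
          push_cast
          rw [thetaTerm_succ hz hq, zpow_natCast]
        rw [if_pos (Nat.succ_pos i), hi, Nat.add_sub_cancel]
        rcases Nat.lt_or_ge i N with h | h
        · obtain ⟨d, rfl⟩ := Nat.exists_eq_add_of_lt h
          have h1 := hne d
          have h2 := hne i
          have h3 : 1 - q * q ^ d ≠ 0 := sub_ne_zero.2 (hq1 d).symm
          have h4 : 1 - q * q ^ i ≠ 0 := sub_ne_zero.2 (hq1 i).symm
          rw [if_pos (by omega), gaussBinom, gaussBinom, gaussBinom,
            show i + d + 1 + 1 - (i + 1) = d + 1 by omega,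
            show i + d + 1 - (i + 1) = d by omega, show i + d + 1 - i = d + 1 by omega,
            qPochFin_succ _ _ (i + d + 1), qPochFin_succ _ _ d, qPochFin_succ _ _ i]
          field_simp
          ring
        · obtain rfl : i = N := by omega
          have h1 := hne i
          have h2 := hne (i + 1)
          rw [if_neg (by omega)]
          simp [gaussBinom, h1, h2, hq0]
    rw [sum_congr rfl hpt, sum_add_distrib, sum_range_succ, sum_range_succ' _ (N + 1),
      if_neg (by omega), if_neg (by omega), add_zero, add_zero, qPochFin_succ, ih,
      sum_congr rfl fun j hj => if_pos (Nat.lt_succ_iff.1 (mem_range.1 hj)),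
      sum_congr rfl fun j _ => if_pos (Nat.succ_pos j), ← mul_sum]
    simp only [Nat.add_sub_cancel]
    ring

/-- The consecutive ratio w q^n tends to 0, so the ratio test applies; both tails of the theta
series have this shape. -/
lemma summable_norm_of_ratio {f : ℕ → ℂ} {q w : ℂ} (hq1 : ‖q‖ < 1) (hf : ∀ n, f n ≠ 0)
    (h : ∀ n, f (n + 1) = w * q ^ n * f n) : Summable fun n => ‖f n‖ := by
  have hlim : Tendsto (fun n : ℕ => ‖w * q ^ n‖) atTop (𝓝 0) := by
    simpa using ((tendsto_pow_atTop_nhds_zero_of_norm_lt_one hq1).const_mul w).norm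
  refine summable_of_ratio_test_tendsto_lt_one (l := 0) one_pos
    (Eventually.of_forall fun n => norm_ne_zero_iff.2 (hf n)) (hlim.congr fun n => ?_)
  rw [norm_norm, norm_norm, h, norm_mul _ (f n), mul_div_assoc, div_self (norm_ne_zero_iff.2 (hf n)), mul_one]

lemma thetaTerm_ne_zero {z q : ℂ} (hz : z ≠ 0) (hq : q ≠ 0) (k : ℤ) : thetaTerm z q k ≠ 0 :=
  mul_ne_zero (mul_ne_zero (zpow_ne_zero _ (by norm_num)) (zpow_ne_zero _ hq)) (zpow_ne_zero _ hz)

lemma summable_thetaTerm {z q : ℂ} (hz : z ≠ 0) (hq : q ≠ 0) (hq1 : ‖q‖ < 1) :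
    Summable fun k : ℤ => ‖thetaTerm z q k‖ := by
  refine Summable.of_nat_of_neg_add_one ?_ ?_
  · refine summable_norm_of_ratio (w := -z) hq1 (fun n => thetaTerm_ne_zero hz hq n) fun n => ?_
    push_cast
    rw [thetaTerm_succ hz hq, zpow_natCast]
    ring
  · refine summable_norm_of_ratio (f := fun n : ℕ => thetaTerm z q (-((n : ℤ) + 1)))
      (w := -(q ^ 2 / z)) hq1 (fun n => thetaTerm_ne_zero hz hq _) fun n => ?_
    have h := thetaTerm_succ hz hq (-((n + 1 : ℕ) + 1 : ℤ))
    rw [show -((n + 1 : ℕ) + 1 : ℤ) + 1 = -((n : ℤ) + 1) by push_cast; ring] at h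
    rw [h, show -((n + 1 : ℕ) + 1 : ℤ) = -((n + 2 : ℕ) : ℤ) by push_cast; ring, zpow_neg,
      zpow_natCast]
    field_simp
    ring

/-- The Jacobi triple product identity. -/
theorem hasSum_theta {z q : ℂ} (hz : z ≠ 0) (hq : q ≠ 0) (hq1 : ‖q‖ < 1) :
    HasSum (thetaTerm z q) (theta z q) := by
  have hqq := mul_pow_ne_one hq1 hq1
  have hE : qPoch q q ≠ 0 := qPoch_ne_zero_of_norm_lt hq1 hq1
  have hprod : ∀ n : ℕ, ∏ i ∈ range n, -(z * (q ^ (i + 1))⁻¹) =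
      (-1) ^ (n : ℤ) * z ^ (n : ℤ) * (q ^ (((n : ℤ) + 1) * (n + 1 - 1) / 2))⁻¹ := by
    intro n
    induction n with
    | zero => simp
    | succ n ih =>
      rw [prod_range_succ, ih]
      push_cast
      rw [triangle_succ ((n : ℤ) + 1), zpow_add₀ hq, zpow_add_one₀ hz, zpow_add_one₀ (by norm_num)]
      simp only [zpow_add_one₀ hq, zpow_natCast, mul_inv]
      ring
  -- The q-binomial theorem for (z q^(-n); q)_(2n), divided by the product that comes from reversing
  -- its first n factors.
  have hfin : ∀ n : ℕ, ∑ j ∈ range (2 * n + 1), gaussBinom q (2 * n) j * thetaTerm z q ((j : ℤ) - n) =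
      qPochFin (q / z) q n * qPochFin z q n := by
    intro n
    have h0 : ∏ i ∈ range n, -(z * (q ^ (i + 1))⁻¹) ≠ 0 :=
      prod_ne_zero_iff.2 fun i _ => neg_ne_zero.2 (mul_ne_zero hz (inv_ne_zero (pow_ne_zero _ hq)))
    have h1 := qPochFin_eq_sum (mul_ne_zero hz (inv_ne_zero (pow_ne_zero n hq))) hq hqq (2 * n)
    rw [two_mul, qPochFin_add, qPochFin_shift hz hq, inv_mul_cancel_right₀ (pow_ne_zero n hq),
      ← two_mul, mul_assoc] at h1
    refine mul_left_cancel₀ h0 (Eq.trans ?_ h1.symm)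
    rw [mul_sum]
    refine sum_congr rfl fun j _ => ?_
    rw [hprod, thetaTerm, thetaTerm, mul_zpow, inv_zpow', ← zpow_natCast q n, ← zpow_mul]
    have h2 : q ^ (((j : ℤ) - n) * (j - n - 1) / 2) * (q ^ (((n : ℤ) + 1) * (n + 1 - 1) / 2))⁻¹ =
        q ^ ((j : ℤ) * (j - 1) / 2) * q ^ ((n : ℤ) * -j) := by
      rw [← zpow_neg, ← zpow_add₀ hq, ← zpow_add₀ hq]
      congr 1
      have e1 := two_mul_triangle (j - n)
      have e2 := two_mul_triangle (n + 1)
      have e3 := two_mul_triangle j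
      linarith
    have h3 : ∀ y : ℂ, y ≠ 0 → y ^ (n : ℤ) * y ^ ((j : ℤ) - n) = y ^ (j : ℤ) := by
      intro y hy
      rw [← zpow_add₀ hy]
      congr 1
      ring
    rw [← h3 z hz, ← h3 (-1) (by norm_num)]
    linear_combination (gaussBinom q (2 * n) j * (-1) ^ (n : ℤ) * (-1) ^ ((j : ℤ) - n) *
      z ^ (n : ℤ) * z ^ ((j : ℤ) - n)) * h2
  obtain ⟨C₁, hC₁⟩ := exists_norm_qPochFin_le q hq1
  obtain ⟨C₃, hC₃⟩ := exists_norm_inv_qPochFin_le hq1 hqq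
  have hC1 := (norm_nonneg _).trans (hC₁ 0)
  have hC3 := (norm_nonneg _).trans (hC₃ 0)
  have hsum := summable_thetaTerm hz hq hq1
  have hterm : ∀ n j : ℕ, gaussBinom q n j =
      qPochFin q q n * ((qPochFin q q (n - j))⁻¹ * (qPochFin q q j)⁻¹) := by
    intro n j
    rw [gaussBinom, div_eq_mul_inv, mul_inv]
  have hlim := tendsto_sum_range_two_mul
    (g := fun n j => gaussBinom q (2 * n) j * thetaTerm z q ((j : ℤ) - n))
    (h := fun k => qPoch q q * ((qPoch q q)⁻¹ * (qPoch q q)⁻¹) * thetaTerm z q k)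
    (bound := fun k => C₁ * (C₃ * C₃) * ‖thetaTerm z q k‖) (hsum.mul_left _)
    (fun n j _ => by
      simp only [hterm]
      rw [norm_mul, norm_mul _ (_ * _), norm_mul _ (_)⁻¹]
      gcongr
      exacts [hC₁ _, hC₃ _, hC₃ _])
    (fun k => by
      simp only [hterm]
      refine Tendsto.mul ?_ (tendsto_const_nhds.congr' ?_)
      · have h1 := tendsto_toNat_add k
        have h2 := tendsto_two_mul_sub_toNat_add k
        exact ((tendsto_qPochFin q hq1).comp (tendsto_id.const_mul_atTop' two_pos)).mul
          ((((tendsto_qPochFin q hq1).comp h2).inv₀ hE).mul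
            (((tendsto_qPochFin q hq1).comp h1).inv₀ hE))
      · filter_upwards [eventually_ge_atTop k.natAbs] with n hn
        rw [show (((n + k).toNat : ℕ) : ℤ) - n = k by omega])
  simp only [hfin] at hlim
  have := tendsto_nhds_unique hlim ((tendsto_qPochFin _ hq1).mul (tendsto_qPochFin _ hq1))
  rw [tsum_mul_left] at this
  have hth : theta z q = ∑' k, thetaTerm z q k := by
    rw [theta, mul_comm (qPoch z q), ← this]
    field_simp
  rw [hth]
  exact hsum.of_norm.hasSum

/-! ### Sums and differences of products of two theta functions -/

lemma hasSum_theta_mul_theta {z w p : ℂ} (hz : z ≠ 0) (hw : w ≠ 0) (hp : p ≠ 0) (hp1 : ‖p‖ < 1) :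
    HasSum (fun m : ℤ × ℤ => thetaTerm z p m.1 * thetaTerm w p m.2) (theta z p * theta w p) := by
  have h1 := summable_thetaTerm hz hp hp1
  have h2 := summable_thetaTerm hw hp hp1
  exact (hasSum_theta hz hp hp1).mul (hasSum_theta hw hp hp1) (summable_mul_of_summable_norm h1 h2)

lemma neg_one_zpow_sub (u v : ℤ) : (-1 : ℂ) ^ (u - v) = (-1) ^ u * (-1) ^ v := by
  rw [zpow_sub₀ (by norm_num), div_eq_mul_inv, ← inv_zpow, inv_neg, inv_one]

lemma neg_one_zpow_mul_self (u : ℤ) : (-1 : ℂ) ^ u * (-1) ^ u = 1 := by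
  rw [← mul_zpow]; simp

theorem theta_mul_theta_neg_add {z w p : ℂ} (hz : z ≠ 0) (hw : w ≠ 0) (hp : p ≠ 0)
    (hp1 : ‖p‖ < 1) :
    theta z p * theta (-w) p + theta (-z) p * theta w p =
      2 * (theta (z * w) (p ^ 2) * theta (p * z / w) (p ^ 2)) := by
  have h1 := (hasSum_theta_mul_theta hz (neg_ne_zero.2 hw) hp hp1).add
    (hasSum_theta_mul_theta (neg_ne_zero.2 hz) hw hp hp1)
  have h2 := (hasSum_theta_mul_theta (mul_ne_zero hz hw) (div_ne_zero (mul_ne_zero hp hz) hw)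
    (pow_ne_zero 2 hp) (norm_pow_lt_one hp1 two_ne_zero)).mul_left 2
  -- The terms at (m, n) combine with the factor (-1)^m + (-1)^n, which vanishes unless m + n is
  -- even; such pairs are exactly (u + v, u - v).
  let e : ℤ × ℤ → ℤ × ℤ := fun m => (m.1 + m.2, m.1 - m.2)
  have he : Function.Injective e := by
    rintro ⟨u, v⟩ ⟨u', v'⟩ h
    simp only [e, Prod.mk.injEq] at h ⊢
    omega
  rw [← he.hasSum_iff] at h1
  · refine h1.unique (h2.congr_fun ?_)
    rintro ⟨u, v⟩
    simp only [Function.comp, e, thetaTerm_neg]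
    have hT : p ^ ((u + v) * (u + v - 1) / 2) * p ^ ((u - v) * (u - v - 1) / 2) =
        (p ^ 2) ^ (u * (u - 1) / 2) * (p ^ 2) ^ (v * (v - 1) / 2) * p ^ v := by
      rw [← zpow_natCast p 2, ← zpow_mul, ← zpow_mul, ← zpow_add₀ hp, ← zpow_add₀ hp,
        ← zpow_add₀ hp]
      congr 1
      have e1 := two_mul_triangle (u + v)
      have e2 := two_mul_triangle (u - v)
      have e3 := two_mul_triangle u
      have e4 := two_mul_triangle v
      push_cast
      linarith
    simp only [thetaTerm, neg_one_zpow_sub, zpow_add₀ (show (-1 : ℂ) ≠ 0 by norm_num),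
      zpow_add₀ hz, zpow_sub₀ hw, mul_zpow, div_zpow]
    have s1 := neg_one_zpow_mul_self u
    have s2 := neg_one_zpow_mul_self v
    generalize (-1 : ℂ) ^ u = a at *
    generalize (-1 : ℂ) ^ v = b at *
    linear_combination (2 * a * b * z ^ u * z ^ v * w ^ u / w ^ v) * (a * a * b * b * hT + 
      (b * b * s1 + s2) * ((p ^ 2) ^ (u * (u - 1) / 2) * (p ^ 2) ^ (v * (v - 1) / 2) * p ^ v))
  · rintro ⟨m, n⟩ h
    have hodd : Odd (m + n) := by
      rw [← Int.not_even_iff_odd]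
      rintro ⟨r, hr⟩
      exact h ⟨(r, m - r), by simp only [e, Prod.mk.injEq]; omega⟩
    have h3 : (-1 : ℂ) ^ m * (-1) ^ n = -1 := by
      rw [← zpow_add₀ (by norm_num), hodd.neg_one_zpow]
    have s1 := neg_one_zpow_mul_self m
    simp only [thetaTerm_neg]
    generalize (-1 : ℂ) ^ m = a at *
    generalize (-1 : ℂ) ^ n = b at *
    linear_combination (thetaTerm z p m * thetaTerm w p n) * (a * h3 - b * s1)

theorem theta_neg_mul_theta_sub {z w p : ℂ} (hz : z ≠ 0) (hw : w ≠ 0) (hp : p ≠ 0)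
    (hp1 : ‖p‖ < 1) :
    theta (-z) p * theta w p - theta z p * theta (-w) p =
      2 * z * (theta (p * z * w) (p ^ 2) * theta (p ^ 2 * z / w) (p ^ 2)) := by
  have h1 := (hasSum_theta_mul_theta (neg_ne_zero.2 hz) hw hp hp1).sub
    (hasSum_theta_mul_theta hz (neg_ne_zero.2 hw) hp hp1)
  have h2 := (hasSum_theta_mul_theta (mul_ne_zero (mul_ne_zero hp hz) hw)
    (div_ne_zero (mul_ne_zero (pow_ne_zero 2 hp) hz) hw)
    (pow_ne_zero 2 hp) (norm_pow_lt_one hp1 two_ne_zero)).mul_left (2 * z)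
  -- Here the factor is (-1)^m - (-1)^n, so only odd m + n survives; the extra 1 in the first index
  -- produces the factor z.
  let e : ℤ × ℤ → ℤ × ℤ := fun m => (m.1 + m.2 + 1, m.1 - m.2)
  have he : Function.Injective e := by
    rintro ⟨u, v⟩ ⟨u', v'⟩ h
    simp only [e, Prod.mk.injEq] at h ⊢
    omega
  rw [← he.hasSum_iff] at h1
  · refine h1.unique (h2.congr_fun ?_)
    rintro ⟨u, v⟩
    simp only [Function.comp, e, thetaTerm_neg]
    have hT : p ^ ((u + v + 1) * (u + v + 1 - 1) / 2) * p ^ ((u - v) * (u - v - 1) / 2) =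
        (p ^ 2) ^ (u * (u - 1) / 2) * (p ^ 2) ^ (v * (v - 1) / 2) * p ^ u * (p ^ 2) ^ v := by
      rw [← zpow_natCast p 2, ← zpow_mul, ← zpow_mul, ← zpow_mul, ← zpow_add₀ hp, ← zpow_add₀ hp,
        ← zpow_add₀ hp, ← zpow_add₀ hp]
      congr 1
      have e1 := two_mul_triangle (u + v + 1)
      have e2 := two_mul_triangle (u - v)
      have e3 := two_mul_triangle u
      have e4 := two_mul_triangle v
      push_cast
      linarith
    simp only [thetaTerm, neg_one_zpow_sub, zpow_add₀ (show (-1 : ℂ) ≠ 0 by norm_num),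
      zpow_add₀ hz, zpow_sub₀ hw, mul_zpow, div_zpow, zpow_one]
    have s1 := neg_one_zpow_mul_self u
    have s2 := neg_one_zpow_mul_self v
    generalize (-1 : ℂ) ^ u = a at *
    generalize (-1 : ℂ) ^ v = b at *
    linear_combination (2 * a * b * z ^ u * z ^ v * z * w ^ u / w ^ v) * (a * a * b * b * hT +
      (b * b * s1 + s2) *
        ((p ^ 2) ^ (u * (u - 1) / 2) * (p ^ 2) ^ (v * (v - 1) / 2) * p ^ u * (p ^ 2) ^ v))
  · rintro ⟨m, n⟩ h
    have heven : Even (m + n) := by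
      rw [← Int.not_odd_iff_even]
      rintro ⟨r, hr⟩
      exact h ⟨(r, m - r - 1), by simp only [e, Prod.mk.injEq]; omega⟩
    have h3 : (-1 : ℂ) ^ m * (-1) ^ n = 1 := by
      rw [← zpow_add₀ (by norm_num), heven.neg_one_zpow]
    have s1 := neg_one_zpow_mul_self m
    simp only [thetaTerm_neg]
    generalize (-1 : ℂ) ^ m = a at *
    generalize (-1 : ℂ) ^ n = b at *
    linear_combination (thetaTerm z p m * thetaTerm w p n) * (b * s1 - a * h3)

/-! ### X and Y in terms of theta functions and Lambert series -/

lemma X_ne_zero {q : ℂ} (hq : ‖q‖ < 1) : X q ≠ 0 := by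
  have h5 := norm_pow_lt_one hq (n := 5) (by norm_num)
  refine mul_ne_zero (mul_ne_zero (mul_ne_zero ?_ ?_) ?_) ?_ <;>
    refine qPoch_ne_zero_of_norm_lt h5 ?_
  · exact hq
  · rw [norm_neg]; exact norm_pow_lt_one hq (by norm_num)
  · rw [norm_neg]; exact norm_pow_lt_one hq (by norm_num)
  · exact norm_pow_lt_one hq (by norm_num)

lemma Y_ne_zero {q : ℂ} (hq : ‖q‖ < 1) : Y q ≠ 0 := by
  have h5 := norm_pow_lt_one hq (n := 5) (by norm_num)
  refine mul_ne_zero (mul_ne_zero (mul_ne_zero ?_ ?_) ?_) ?_ <;>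
    refine qPoch_ne_zero_of_norm_lt h5 ?_
  · rw [norm_neg]; exact hq
  · exact norm_pow_lt_one hq (by norm_num)
  · exact norm_pow_lt_one hq (by norm_num)
  · rw [norm_neg]; exact norm_pow_lt_one hq (by norm_num)

lemma X_mul {q : ℂ} (hq0 : q ≠ 0) :
    X q * qPoch (q ^ 5) (q ^ 5) ^ 2 = theta q (q ^ 5) * theta (-q ^ 2) (q ^ 5) := by
  rw [theta, theta, X, show q ^ 5 / q = q ^ 4 by field_simp,
    show q ^ 5 / -q ^ 2 = -q ^ 3 by field_simp]
  ring

lemma Y_mul {q : ℂ} (hq0 : q ≠ 0) :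
    Y q * qPoch (q ^ 5) (q ^ 5) ^ 2 = theta (-q) (q ^ 5) * theta (q ^ 2) (q ^ 5) := by
  rw [theta, theta, Y, show q ^ 5 / -q = -q ^ 4 by field_simp,
    show q ^ 5 / q ^ 2 = q ^ 3 by field_simp]
  ring

lemma X_mul_Y {q : ℂ} (hq : ‖q‖ < 1) :
    X q * Y q = qPoch (q ^ 2) (q ^ 10) * qPoch (q ^ 4) (q ^ 10) * qPoch (q ^ 6) (q ^ 10) *
      qPoch (q ^ 8) (q ^ 10) := by
  have h5 := norm_pow_lt_one hq (n := 5) (by norm_num)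
  have h1 := qPoch_mul_qPoch_neg q h5
  have h2 := qPoch_mul_qPoch_neg (q ^ 2) h5
  have h3 := qPoch_mul_qPoch_neg (q ^ 3) h5
  have h4 := qPoch_mul_qPoch_neg (q ^ 4) h5
  simp only [← pow_mul, Nat.reduceMul] at h1 h2 h3 h4
  rw [← h1, ← h2, ← h3, ← h4, X, Y]
  ring

lemma qPoch_five {q : ℂ} (hq : ‖q‖ < 1) :
    qPoch (q ^ 5) (q ^ 5) = qPoch (q ^ 5) (q ^ 10) * qPoch (q ^ 10) (q ^ 10) := by
  have := qPoch_eq_even_mul_odd (q ^ 5) (norm_pow_lt_one hq (n := 5) (by norm_num))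
  simpa only [← pow_mul, ← pow_add, Nat.reduceMul, Nat.reduceAdd] using this

lemma X_add_Y_mul {q : ℂ} (hq0 : q ≠ 0) (hq : ‖q‖ < 1) :
    (X q + Y q) * qPoch (q ^ 5) (q ^ 5) ^ 2 =
      2 * (theta (q ^ 3) (q ^ 10) * theta (q ^ 4) (q ^ 10)) := by
  have := theta_mul_theta_neg_add hq0 (pow_ne_zero 2 hq0) (pow_ne_zero 5 hq0)
    (norm_pow_lt_one hq (n := 5) (by norm_num))
  rw [show q ^ 5 * q / q ^ 2 = q ^ 4 by field_simp, show q * q ^ 2 = q ^ 3 by ring, ← pow_mul]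
    at this
  rw [← this, add_mul, X_mul hq0, Y_mul hq0]

lemma Y_sub_X_mul {q : ℂ} (hq0 : q ≠ 0) (hq : ‖q‖ < 1) :
    (Y q - X q) * qPoch (q ^ 5) (q ^ 5) ^ 2 =
      2 * q * (theta (q ^ 8) (q ^ 10) * theta (q ^ 9) (q ^ 10)) := by
  have := theta_neg_mul_theta_sub hq0 (pow_ne_zero 2 hq0) (pow_ne_zero 5 hq0)
    (norm_pow_lt_one hq (n := 5) (by norm_num))
  rw [show (q ^ 5) ^ 2 * q / q ^ 2 = q ^ 9 by field_simp, show q ^ 5 * q * q ^ 2 = q ^ 8 by ring,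
    ← pow_mul] at this
  rw [← this, sub_mul, X_mul hq0, Y_mul hq0]

/-- Rewrites the denominator X Y so that, after `X_add_Y_mul` or `Y_sub_X_mul`, one theta factor
cancels and a Kronecker quotient with x = q^5 and base q^10 remains. -/
lemma theta_two_mul_four_mul_five {q : ℂ} (hq0 : q ≠ 0) (hq : ‖q‖ < 1) :
    theta (q ^ 2) (q ^ 10) * theta (q ^ 4) (q ^ 10) * theta (q ^ 5) (q ^ 10) =
      X q * Y q * qPoch (q ^ 5) (q ^ 5) ^ 2 * qPoch (q ^ 10) (q ^ 10) := by
  rw [X_mul_Y hq, qPoch_five hq, theta, theta, theta, show q ^ 10 / q ^ 2 = q ^ 8 by field_simp,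
    show q ^ 10 / q ^ 4 = q ^ 6 by field_simp, show q ^ 10 / q ^ 5 = q ^ 5 by field_simp]
  ring

lemma pow_mul_zpow_ne_one {q : ℂ} (hq0 : q ≠ 0) (hq : ‖q‖ < 1) {c : ℕ} (hc0 : 0 < c)
    (hc : c < 10) (k : ℤ) : q ^ c * (q ^ 10) ^ k ≠ 1 := by
  intro h
  rw [← zpow_natCast, ← zpow_natCast, ← zpow_mul, ← zpow_add₀ hq0] at h
  have h1 := congrArg norm h
  rw [norm_zpow, norm_one] at h1
  have := (zpow_eq_one_iff_right₀ (norm_nonneg q) hq.ne).1 h1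
  omega

lemma tsum_kronecker_pow {q : ℂ} (hq0 : q ≠ 0) (hq : ‖q‖ < 1) {c : ℕ} (hc0 : 0 < c)
    (hc : c < 10) :
    (∑' k : ℤ, (q ^ 5) ^ k / (1 - q ^ c * (q ^ 10) ^ k)) *
      (theta (q ^ c) (q ^ 10) * theta (q ^ 5) (q ^ 10)) =
      qPoch (q ^ 10) (q ^ 10) ^ 3 * theta (q ^ c * q ^ 5) (q ^ 10) := by
  refine tsum_kronecker (pow_ne_zero c hq0) (pow_ne_zero 10 hq0)
    (norm_pow_lt_one hq (by norm_num)) (norm_pow_lt_one hq (by norm_num)) ?_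
    (pow_mul_zpow_ne_one hq0 hq hc0 hc)
  rw [norm_pow, norm_pow]
  exact pow_lt_pow_right_of_lt_one₀ (norm_pos_iff.2 hq0) hq (by norm_num)

theorem inv_X_add_inv_Y {q : ℂ} (hq0 : q ≠ 0) (hq : ‖q‖ < 1) :
    ((X q)⁻¹ + (Y q)⁻¹) * qPoch (q ^ 10) (q ^ 10) ^ 2 =
      2 * ∑' k : ℤ, (q ^ 5) ^ k / (1 - q ^ 2 * (q ^ 10) ^ k) := by
  have h1 := tsum_kronecker_pow hq0 hq (c := 2) (by norm_num) (by norm_num)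
  have h2 := X_add_Y_mul hq0 hq
  have h3 := theta_two_mul_four_mul_five hq0 hq
  have h4 : theta (q ^ 3) (q ^ 10) = theta (q ^ 2 * q ^ 5) (q ^ 10) := by
    rw [← theta_div _ (pow_ne_zero 10 hq0)]
    congr 1
    field_simp
  have hX := X_ne_zero hq
  have hY := Y_ne_zero hq
  have hP : qPoch (q ^ 5) (q ^ 5) ≠ 0 := qPoch_ne_zero_of_norm_lt
    (norm_pow_lt_one hq (by norm_num)) (norm_pow_lt_one hq (by norm_num))
  have hE : qPoch (q ^ 10) (q ^ 10) ≠ 0 := qPoch_ne_zero_of_norm_lt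
    (norm_pow_lt_one hq (by norm_num)) (norm_pow_lt_one hq (by norm_num))
  rw [h4] at h2
  rw [inv_add_inv hX hY, div_mul_eq_mul_div, div_eq_iff (mul_ne_zero hX hY)]
  refine mul_right_cancel₀ (mul_ne_zero (pow_ne_zero 2 hP) hE) ?_
  linear_combination qPoch (q ^ 10) (q ^ 10) ^ 3 * h2 +
    2 * (∑' k : ℤ, (q ^ 5) ^ k / (1 - q ^ 2 * (q ^ 10) ^ k)) * h3 - 2 * theta (q ^ 4) (q ^ 10) * h1

theorem inv_X_sub_inv_Y {q : ℂ} (hq0 : q ≠ 0) (hq : ‖q‖ < 1) :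
    ((X q)⁻¹ - (Y q)⁻¹) * qPoch (q ^ 10) (q ^ 10) ^ 2 =
      2 * q * ∑' k : ℤ, (q ^ 5) ^ k / (1 - q ^ 4 * (q ^ 10) ^ k) := by
  have h1 := tsum_kronecker_pow hq0 hq (c := 4) (by norm_num) (by norm_num)
  have h2 := Y_sub_X_mul hq0 hq
  have h3 := theta_two_mul_four_mul_five hq0 hq
  have h4 : theta (q ^ 8) (q ^ 10) = theta (q ^ 2) (q ^ 10) := by
    rw [← theta_div _ (pow_ne_zero 10 hq0)]
    congr 1
    field_simp
  have hX := X_ne_zero hq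
  have hY := Y_ne_zero hq
  have hP : qPoch (q ^ 5) (q ^ 5) ≠ 0 := qPoch_ne_zero_of_norm_lt
    (norm_pow_lt_one hq (by norm_num)) (norm_pow_lt_one hq (by norm_num))
  have hE : qPoch (q ^ 10) (q ^ 10) ≠ 0 := qPoch_ne_zero_of_norm_lt
    (norm_pow_lt_one hq (by norm_num)) (norm_pow_lt_one hq (by norm_num))
  rw [h4] at h2
  rw [← pow_add] at h1
  rw [inv_sub_inv hX hY, div_mul_eq_mul_div, div_eq_iff (mul_ne_zero hX hY)]
  refine mul_right_cancel₀ (mul_ne_zero (pow_ne_zero 2 hP) hE) ?_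
  linear_combination qPoch (q ^ 10) (q ^ 10) ^ 3 * h2 +
    2 * q * (∑' k : ℤ, (q ^ 5) ^ k / (1 - q ^ 4 * (q ^ 10) ^ k)) * h3 -
    2 * q * theta (q ^ 2) (q ^ 10) * h1

/-! ### Generating functions of weighted partition numbers -/

section GeneratingFunction

open scoped PowerSeries PowerSeries.WithPiTopology

/-- The geometric series `1 / (1 - c X ^ m)`. -/
noncomputable def geomSeries (c : ℂ) (m : ℕ) : ℂ⟦X⟧ :=
  PowerSeries.mk fun n => if m ∣ n then c ^ (n / m) else 0

lemma hasSum_geomSeries {c q : ℂ} {m : ℕ} (hm : 0 < m) (h : ‖c * q ^ m‖ < 1) :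
    HasSum (fun n => PowerSeries.coeff n (geomSeries c m) * q ^ n) (1 - c * q ^ m)⁻¹ := by
  have hinj : Function.Injective fun j : ℕ => m * j := fun a b hab => Nat.eq_of_mul_eq_mul_left hm hab
  rw [← hinj.hasSum_iff]
  · refine (hasSum_geometric_of_norm_lt_one h).congr_fun fun j => ?_
    simp [geomSeries, Nat.mul_div_cancel_left _ hm, mul_pow, pow_mul]
  · intro n hn
    have : ¬ m ∣ n := fun ⟨d, hd⟩ => hn ⟨d, hd.symm⟩
    simp [geomSeries, this]

lemma norm_coeff_geomSeries (c : ℂ) (m n : ℕ) :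
    ((‖PowerSeries.coeff n (geomSeries c m)‖ : ℝ) : ℂ) =
      PowerSeries.coeff n (geomSeries (‖c‖ : ℂ) m) := by
  simp only [geomSeries, PowerSeries.coeff_mk]
  split_ifs <;> simp

lemma hasSum_norm_geomSeries {c : ℂ} {ρ : ℝ} {m : ℕ} (hm : 0 < m) (hρ : 0 ≤ ρ)
    (h : ‖c‖ * ρ ^ m < 1) :
    HasSum (fun n => ‖PowerSeries.coeff n (geomSeries c m)‖ * ρ ^ n) (1 - ‖c‖ * ρ ^ m)⁻¹ := by
  have h1 := hasSum_geomSeries (c := (‖c‖ : ℂ)) (q := (ρ : ℂ)) hm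
    (by simpa [abs_of_nonneg hρ] using h)
  simp only [← norm_coeff_geomSeries] at h1
  exact_mod_cast h1

lemma one_add_tsum_eq_geomSeries (c : ℂ) {m : ℕ} (hm : 0 < m) :
    1 + ∑' j : ℕ, c ^ (j + 1) • (PowerSeries.X : ℂ⟦X⟧) ^ (m * (j + 1)) = geomSeries c m := by
  have h : HasSum (fun j : ℕ => c ^ j • (PowerSeries.X : ℂ⟦X⟧) ^ (m * j)) (geomSeries c m) := by
    rw [PowerSeries.WithPiTopology.hasSum_iff_hasSum_coeff]
    intro n
    by_cases hn : m ∣ n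
    · obtain ⟨d, rfl⟩ := hn
      convert hasSum_single d ?_ using 1
      · simp [geomSeries, Nat.mul_div_cancel_left _ hm, PowerSeries.coeff_X_pow]
      · intro j hj
        simp [PowerSeries.coeff_X_pow, hm.ne', hj.symm]
    · convert hasSum_zero using 1
      · ext j
        have : n ≠ m * j := fun h => hn ⟨j, h⟩
        simp [PowerSeries.coeff_X_pow, this]
      · simp [geomSeries, hn]
  rw [← h.tsum_eq, h.summable.tsum_eq_zero_add]
  simp

/-- The norm ∑ |a_n| ρ^n is submultiplicative; this bounds the coefficients of all partial products
at once. -/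
lemma summable_norm_coeff_mul {A B : ℂ⟦X⟧} {ρ : ℝ} (hρ : 0 ≤ ρ)
    (hA : Summable fun n => ‖PowerSeries.coeff n A‖ * ρ ^ n)
    (hB : Summable fun n => ‖PowerSeries.coeff n B‖ * ρ ^ n) :
    (Summable fun n => ‖PowerSeries.coeff n (A * B)‖ * ρ ^ n) ∧
    ∑' n, ‖PowerSeries.coeff n (A * B)‖ * ρ ^ n ≤
      (∑' n, ‖PowerSeries.coeff n A‖ * ρ ^ n) * ∑' n, ‖PowerSeries.coeff n B‖ * ρ ^ n := by
  have hA' : Summable fun n => ‖‖PowerSeries.coeff n A‖ * ρ ^ n‖ := hA.norm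
  have hB' : Summable fun n => ‖‖PowerSeries.coeff n B‖ * ρ ^ n‖ := hB.norm
  have hs := (summable_norm_sum_mul_antidiagonal_of_summable_norm hA' hB').of_norm
  have hle : ∀ n, ‖PowerSeries.coeff n (A * B)‖ * ρ ^ n ≤ ∑ kl ∈ antidiagonal n,
      (‖PowerSeries.coeff kl.1 A‖ * ρ ^ kl.1) * (‖PowerSeries.coeff kl.2 B‖ * ρ ^ kl.2) := by
    intro n
    rw [PowerSeries.coeff_mul]
    refine (mul_le_mul_of_nonneg_right (norm_sum_le _ _) (pow_nonneg hρ n)).trans_eq ?_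
    rw [sum_mul]
    refine sum_congr rfl fun kl hkl => ?_
    rw [← mem_antidiagonal.1 hkl, norm_mul, pow_add]
    ring
  have h1 := Summable.of_nonneg_of_le (fun n => by positivity) hle hs
  refine ⟨h1, ?_⟩
  rw [tsum_mul_tsum_eq_tsum_sum_antidiagonal_of_summable_norm hA' hB']
  exact h1.tsum_le_tsum hle hs

lemma hasSum_coeff_mul {A B : ℂ⟦X⟧} {q a b : ℂ}
    (hA : HasSum (fun n => PowerSeries.coeff n A * q ^ n) a)
    (hB : HasSum (fun n => PowerSeries.coeff n B * q ^ n) b) :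
    HasSum (fun n => PowerSeries.coeff n (A * B) * q ^ n) (a * b) := by
  have hA' := hA.summable.norm
  have hB' := hB.summable.norm
  have hs := (summable_norm_sum_mul_antidiagonal_of_summable_norm hA' hB').of_norm
  have h := tsum_mul_tsum_eq_tsum_sum_antidiagonal_of_summable_norm hA' hB'
  rw [hA.tsum_eq, hB.tsum_eq] at h
  rw [h]
  refine hs.hasSum.congr_fun fun n => ?_
  rw [PowerSeries.coeff_mul, sum_mul]
  refine sum_congr rfl fun kl hkl => ?_
  rw [← mem_antidiagonal.1 hkl, pow_add]
  ring

/-- The generating function of the partition numbers weighted by the product of the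
values of `c` over the parts. -/
theorem hasSum_partition {c : ℕ → ℤ} (hc : ∀ n, |c n| ≤ 1) {q s : ℂ} (hq : ‖q‖ < 1)
    (hs : Tendsto (fun N => ∏ i ∈ range N, (1 - (c (i + 1) : ℂ) * q ^ (i + 1))) atTop (𝓝 s))
    (hs0 : s ≠ 0) :
    HasSum (fun n => ((∑ π : n.Partition, (π.parts.map c).prod : ℤ) : ℂ) * q ^ n) s⁻¹ := by
  set p : ℕ → ℂ := fun n => ((∑ π : n.Partition, (π.parts.map c).prod : ℤ) : ℂ) with hp
  have hc' : ∀ n, ‖(c n : ℂ)‖ ≤ 1 := fun n => by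
    rw [Complex.norm_intCast]
    exact_mod_cast hc n
  let A : ℕ → ℂ⟦X⟧ := fun N => ∏ i ∈ range N, geomSeries (c (i + 1)) (i + 1)
  -- Formal side: the Euler product for partitions converges coefficientwise.
  have hcoeff : ∀ n, Tendsto (fun N => PowerSeries.coeff n (A N)) atTop (𝓝 (p n)) := by
    have h := (Nat.Partition.hasProd_genFun fun i k => (c i : ℂ) ^ k).tendsto_prod_nat
    simp only [one_add_tsum_eq_geomSeries _ (Nat.succ_pos _)] at h
    intro n
    convert ((PowerSeries.WithPiTopology.continuous_coeff ℂ n).tendsto _).comp h using 2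
    · rfl
    rw [Nat.Partition.coeff_genFun, hp]
    push_cast
    refine sum_congr rfl fun π _ => ?_
    rw [Multiset.map_map, Finset.prod_multiset_map_count, Finsupp.prod, Multiset.toFinsupp_support]
    rfl
  -- Bounding the coefficients at the larger radius ρ leaves the summable majorant C (|q|/ρ)^n,
  -- uniform in the number of factors.
  obtain ⟨ρ, hqρ, hρ1⟩ := exists_between hq
  have hρ0 : 0 < ρ := (norm_nonneg q).trans_lt hqρ
  have hcρ : ∀ i : ℕ, ‖(c (i + 1) : ℂ)‖ * ρ ^ (i + 1) < 1 := fun i =>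
    (mul_le_of_le_one_left (by positivity) (hc' _)).trans_lt
      (pow_lt_one₀ hρ0.le hρ1 (Nat.succ_ne_zero i))
  have hA : ∀ N, HasSum (fun n => PowerSeries.coeff n (A N) * q ^ n)
      (∏ i ∈ range N, (1 - (c (i + 1) : ℂ) * q ^ (i + 1)))⁻¹ := by
    intro N
    induction N with
    | zero =>
      convert hasSum_single 0 ?_ using 1
      · simp [A]
      · intro n hn
        simp [A, PowerSeries.coeff_one, hn]
    | succ N ih =>
      simp only [A, prod_range_succ, mul_inv] at ih ⊢
      refine hasSum_coeff_mul ih (hasSum_geomSeries (Nat.succ_pos N) ?_)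
      rw [norm_mul, norm_pow]
      exact (by gcongr : _ ≤ _).trans_lt (hcρ N)
  obtain ⟨C, hC⟩ : ∃ C : ℝ, ∀ N, ∏ i ∈ range N, (1 - ρ ^ (i + 1))⁻¹ ≤ C := by
    have hρ' : ‖(ρ : ℂ)‖ < 1 := by rwa [Complex.norm_real, Real.norm_of_nonneg hρ0.le]
    obtain ⟨C, hC⟩ := exists_norm_inv_qPochFin_le hρ' (mul_pow_ne_one hρ' hρ')
    refine ⟨C, fun N => (hC N).trans_eq' ?_⟩
    rw [norm_inv, qPochFin, norm_prod, prod_inv_distrib]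
    congr 1
    refine prod_congr rfl fun i _ => ?_
    rw [← pow_succ', ← Complex.ofReal_pow, ← Complex.ofReal_one, ← Complex.ofReal_sub,
      Complex.norm_real, Real.norm_of_nonneg (sub_nonneg.2 (pow_le_one₀ hρ0.le hρ1.le))]
  have hbound : ∀ N, (Summable fun n => ‖PowerSeries.coeff n (A N)‖ * ρ ^ n) ∧
      ∑' n, ‖PowerSeries.coeff n (A N)‖ * ρ ^ n ≤ ∏ i ∈ range N, (1 - ρ ^ (i + 1))⁻¹ := by
    intro N
    induction N with
    | zero =>
      have : HasSum (fun n => ‖PowerSeries.coeff n (A 0)‖ * ρ ^ n) 1 := by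
        convert hasSum_single 0 ?_ using 1
        · simp [A]
        · intro n hn
          simp [A, PowerSeries.coeff_one, hn]
      exact ⟨this.summable, by simp [this.tsum_eq]⟩
    | succ N ih =>
      have h1 := hasSum_norm_geomSeries (Nat.succ_pos N) hρ0.le (hcρ N)
      have h2 := summable_norm_coeff_mul hρ0.le ih.1 h1.summable
      rw [show A (N + 1) = A N * geomSeries (c (N + 1)) (N + 1) from prod_range_succ _ _,
        prod_range_succ]
      refine ⟨h2.1, h2.2.trans ?_⟩
      have h3 : ρ ^ (N + 1) < 1 := pow_lt_one₀ hρ0.le hρ1 (Nat.succ_ne_zero N)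
      rw [h1.tsum_eq]
      refine mul_le_mul ih.2 ?_ (inv_nonneg.2 (sub_nonneg.2 (hcρ N).le))
        (prod_nonneg fun i _ => inv_nonneg.2 (sub_nonneg.2 (pow_le_one₀ hρ0.le hρ1.le)))
      refine inv_anti₀ (sub_pos.2 h3) (sub_le_sub_left ?_ 1)
      exact mul_le_of_le_one_left (by positivity) (hc' _)
  have hAC : ∀ N n, ‖PowerSeries.coeff n (A N)‖ * ρ ^ n ≤ C := fun N n =>
    ((hbound N).1.le_tsum n fun j _ => by positivity).trans ((hbound N).2.trans (hC N))
  have hgeom : Summable fun n : ℕ => C * (‖q‖ / ρ) ^ n :=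
    (summable_geometric_of_lt_one (by positivity) ((div_lt_one hρ0).2 hqρ)).mul_left C
  have hdom : ∀ N n, ‖PowerSeries.coeff n (A N) * q ^ n‖ ≤ C * (‖q‖ / ρ) ^ n := by
    intro N n
    calc ‖PowerSeries.coeff n (A N) * q ^ n‖
        = ‖PowerSeries.coeff n (A N)‖ * ρ ^ n * (‖q‖ / ρ) ^ n := by
          rw [norm_mul, norm_pow, div_pow]
          field_simp
      _ ≤ C * (‖q‖ / ρ) ^ n := mul_le_mul_of_nonneg_right (hAC N n) (by positivity)
  have hlim := tendsto_tsum_of_dominated_convergence (𝓕 := atTop) hgeom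
    (fun n => (hcoeff n).mul_const (q ^ n)) (Eventually.of_forall hdom)
  simp only [(hA _).tsum_eq] at hlim
  rw [tendsto_nhds_unique (hs.inv₀ hs0) hlim]
  refine (Summable.of_norm_bounded hgeom fun n => ?_).hasSum
  exact le_of_tendsto ((hcoeff n).mul_const (q ^ n)).norm (Eventually.of_forall fun N => hdom N n)

/-- The whole sequence converges by absolute summability, so its limit can be read off along
multiples of 5, where the factors group into full periods of `chi5`. -/
lemma tendsto_prod_weight {c : ℕ → ℤ} (hc : ∀ n, |c n| ≤ 1) {q s : ℂ} (hq : ‖q‖ < 1)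
    (hs : Tendsto (fun N => ∏ i ∈ range (5 * N), (1 - (c (i + 1) : ℂ) * q ^ (i + 1))) atTop (𝓝 s)) :
    Tendsto (fun N => ∏ i ∈ range N, (1 - (c (i + 1) : ℂ) * q ^ (i + 1))) atTop (𝓝 s) := by
  have hsum : Summable fun i : ℕ => ‖-((c (i + 1) : ℂ) * q ^ (i + 1))‖ := by
    refine Summable.of_nonneg_of_le (fun _ => norm_nonneg _) (fun i => ?_)
      ((summable_nat_add_iff 1).2 (summable_geometric_of_lt_one (norm_nonneg q) hq))
    rw [norm_neg, norm_mul, norm_pow, Complex.norm_intCast]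
    exact mul_le_of_le_one_left (by positivity) (by exact_mod_cast hc _)
  have h := (multipliable_one_add_of_summable hsum).hasProd.tendsto_prod_nat
  simp only [← sub_eq_add_neg] at h
  rwa [tendsto_nhds_unique hs (h.comp (tendsto_id.const_mul_atTop' (by norm_num : 0 < 5)))]

lemma prod_range_five_mul (f : ℕ → ℂ) (N : ℕ) :
    ∏ i ∈ range (5 * N), f i = ∏ k ∈ range N,
      (f (5 * k) * f (5 * k + 1) * f (5 * k + 2) * f (5 * k + 3) * f (5 * k + 4)) := by
  induction N with
  | zero => simp
  | succ N ih =>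
    rw [prod_range_succ, ← ih, show 5 * (N + 1) = 5 * N + 1 + 1 + 1 + 1 + 1 by ring]
    simp only [prod_range_succ, add_assoc, Nat.reduceAdd, mul_assoc]

lemma chi5_mod (a n : ℕ) : chi5 (5 * a + n) = chi5 n := by
  rw [chi5, chi5, legendreSym.mod, legendreSym.mod 5 (n : ℤ)]
  congr 1
  push_cast
  omega

lemma chi5_values : chi5 1 = 1 ∧ chi5 2 = -1 ∧ chi5 3 = -1 ∧ chi5 4 = 1 ∧ chi5 5 = 0 := by
  simp only [chi5, legendreSym]
  decide

lemma abs_chi5_le (n : ℕ) : |chi5 n| ≤ 1 := by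
  obtain ⟨h1, h2, h3, h4, h5⟩ := chi5_values
  rcases Nat.eq_zero_or_pos n with rfl | hn
  · rw [← chi5_mod 1 0, h5]; norm_num
  · obtain ⟨a, r, hr, rfl⟩ : ∃ a r, r < 5 ∧ n = 5 * a + (r + 1) :=
      ⟨(n - 1) / 5, (n - 1) % 5, Nat.mod_lt _ (by norm_num), by omega⟩
    rw [chi5_mod]
    interval_cases r <;> simp [h1, h2, h3, h4, h5]

theorem hasSum_p5 {q : ℂ} (hq : ‖q‖ < 1) : HasSum (fun n => (p5 n : ℂ) * q ^ n) (X q)⁻¹ := by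
  refine hasSum_partition abs_chi5_le hq (tendsto_prod_weight abs_chi5_le hq ?_) (X_ne_zero hq)
  have h5 := norm_pow_lt_one hq (n := 5) (by norm_num)
  obtain ⟨e1, e2, e3, e4, e5⟩ := chi5_values
  refine ((((tendsto_qPochFin q h5).mul (tendsto_qPochFin (-q ^ 2) h5)).mul
    (tendsto_qPochFin (-q ^ 3) h5)).mul (tendsto_qPochFin (q ^ 4) h5)).congr fun N => ?_
  simp only [prod_range_five_mul, add_assoc, chi5_mod, Nat.reduceAdd, e1, e2, e3, e4, e5, qPochFin,
    ← prod_mul_distrib]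
  refine prod_congr rfl fun i _ => ?_
  push_cast
  ring

theorem hasSum_p5dag {q : ℂ} (hq : ‖q‖ < 1) : HasSum (fun n => (p5dag n : ℂ) * q ^ n) (Y q)⁻¹ := by
  have habs : ∀ n, |-chi5 n| ≤ 1 := fun n => by rw [abs_neg]; exact abs_chi5_le n
  have h5 := norm_pow_lt_one hq (n := 5) (by norm_num)
  obtain ⟨e1, e2, e3, e4, e5⟩ := chi5_values
  have h := hasSum_partition (s := Y q) habs hq (tendsto_prod_weight habs hq
    (((((tendsto_qPochFin (-q) h5).mul (tendsto_qPochFin (q ^ 2) h5)).mul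
    (tendsto_qPochFin (q ^ 3) h5)).mul (tendsto_qPochFin (-q ^ 4) h5)).congr fun N => ?_))
    (Y_ne_zero hq)
  · convert h using 5 with n
    rw [p5dag]
    refine sum_congr rfl fun π _ => ?_
    rw [negChi5Partition, ← Multiset.card_map chi5, ← Multiset.prod_map_neg, Multiset.map_map]
    rfl
  · simp only [prod_range_five_mul, add_assoc, chi5_mod, Nat.reduceAdd, e1, e2, e3, e4, e5, qPochFin,
      ← prod_mul_distrib]
    refine prod_congr rfl fun i _ => ?_
    push_cast
    ring

end GeneratingFunction

/-! ### Uniqueness of power series coefficients -/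

lemma hasFPowerSeriesOnBall_of_hasSum {a : ℕ → ℂ} {f : ℂ → ℂ}
    (h : ∀ q : ℂ, ‖q‖ < 1 → HasSum (fun n => a n * q ^ n) (f q)) :
    HasFPowerSeriesOnBall f (FormalMultilinearSeries.ofScalars ℂ a) 0 1 where
  r_le := by
    refine ENNReal.le_of_forall_nnreal_lt fun r hr => ?_
    have hr1 : (r : ℝ) < 1 := by exact_mod_cast hr
    refine FormalMultilinearSeries.le_radius_of_summable_norm _ ?_
    have h1 := (h (r : ℝ) (by simpa using hr1)).summable.norm
    refine h1.congr fun n => ?_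
    rw [FormalMultilinearSeries.ofScalars_norm]
    simp
  r_pos := one_pos
  hasSum := by
    intro y hy
    have hy' : ‖y‖ < 1 := by
      have h1 : ‖y‖ₑ < 1 := by simpa using hy
      rwa [← ofReal_norm, ENNReal.ofReal_lt_one] at h1
    rw [zero_add]
    refine (h y hy').congr_fun fun n => ?_
    simp [FormalMultilinearSeries.ofScalars]

lemma qCoeff_eq {a : ℕ → ℂ} {f : ℂ → ℂ}
    (h : ∀ q : ℂ, ‖q‖ < 1 → HasSum (fun n => a n * q ^ n) (f q)) (n : ℕ) : qCoeff f n = a n := by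
  have h1 := (hasFPowerSeriesOnBall_of_hasSum h).hasFPowerSeriesAt
  have h2 := h1.analyticAt.hasFPowerSeriesAt.eq_formalMultilinearSeries h1
  exact congrFun (FormalMultilinearSeries.ofScalars_series_injective ℂ ℂ h2) n

/-- The point 0 is excluded because the theta identities divide by q; analyticity recovers it, since
zeros of the sum accumulate at 0. -/
lemma eq_zero_of_hasSum_zero {b : ℕ → ℂ}
    (h : ∀ q : ℂ, q ≠ 0 → ‖q‖ < 1 → HasSum (fun n => b n * q ^ n) 0) (n : ℕ) : b n = 0 := by
  let g : ℂ → ℂ := fun q => if q = 0 then b 0 else 0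
  have hg : ∀ q : ℂ, ‖q‖ < 1 → HasSum (fun n => b n * q ^ n) (g q) := by
    intro q hq
    by_cases hq0 : q = 0
    · subst hq0
      simp only [g, if_true]
      convert hasSum_single 0 ?_ using 1
      · simp
      · intro n hn
        simp [hn]
    · simpa only [g, if_neg hq0] using h q hq0 hq
  have h1 := (hasFPowerSeriesOnBall_of_hasSum hg).hasFPowerSeriesAt
  have h2 : ∀ᶠ z in 𝓝 0, g z = 0 := by
    refine h1.analyticAt.frequently_zero_iff_eventually_zero.1 (Eventually.frequently ?_)
    filter_upwards [self_mem_nhdsWithin] with z hz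
    exact if_neg hz
  have h3 : FormalMultilinearSeries.ofScalars ℂ b = 0 := (h1.congr h2).eq_zero
  have h4 : FormalMultilinearSeries.ofScalars ℂ (0 : ℕ → ℂ) = (0 : FormalMultilinearSeries ℂ ℂ ℂ) := by
    ext; simp [FormalMultilinearSeries.ofScalars]
  exact congrFun (FormalMultilinearSeries.ofScalars_series_injective ℂ ℂ (h3.trans h4.symm)) n

/-! ### The root-of-unity filter -/

/-- A primitive tenth root of unity. -/
noncomputable def zeta : ℂ := Complex.exp (2 * Real.pi * Complex.I / (10 : ℕ))

lemma isPrimitiveRoot_zeta : IsPrimitiveRoot zeta 10 :=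
  Complex.isPrimitiveRoot_exp 10 (by norm_num)

lemma norm_zeta_pow_mul (j : ℕ) (q : ℂ) : ‖zeta ^ j * q‖ = ‖q‖ := by
  rw [norm_mul, norm_pow, isPrimitiveRoot_zeta.norm'_eq_one (by norm_num), one_pow, one_mul]

lemma sum_zeta_pow (m : ℕ) : ∑ j ∈ range 10, zeta ^ (j * m) = if 10 ∣ m then 10 else 0 := by
  have h1 : ∀ j, zeta ^ (j * m) = (zeta ^ m) ^ j := fun j => by rw [← pow_mul, mul_comm]
  simp only [h1]
  split_ifs with h
  · simp [(isPrimitiveRoot_zeta.pow_eq_one_iff_dvd m).2 h]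
  · have h2 : zeta ^ m - 1 ≠ 0 :=
      sub_ne_zero.2 fun h' => h ((isPrimitiveRoot_zeta.pow_eq_one_iff_dvd m).1 h')
    refine mul_right_cancel₀ h2 ?_
    rw [geom_sum_mul, ← pow_mul, mul_comm m, pow_mul, isPrimitiveRoot_zeta.pow_eq_one, one_pow]
    simp

/-- Ten times the part of `f` with exponents congruent to `-s` modulo `10`. -/
noncomputable def rootSum (s : ℕ) (f : ℂ → ℂ) (q : ℂ) : ℂ :=
  ∑ j ∈ range 10, zeta ^ (j * s) * f (zeta ^ j * q)

/-- The index type is arbitrary because the same exponent may occur repeatedly in the Lambert double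
series. -/
lemma hasSum_rootSum {ι : Type*} {a : ι → ℂ} {e : ι → ℕ} {f : ℂ → ℂ} {q : ℂ}
    (hf : ∀ w : ℂ, ‖w‖ = ‖q‖ → HasSum (fun i => a i * w ^ e i) (f w)) (s : ℕ) :
    HasSum (fun i => if 10 ∣ s + e i then 10 * (a i * q ^ e i) else 0) (rootSum s f q) := by
  refine (hasSum_sum fun j _ =>
    (hf (zeta ^ j * q) (norm_zeta_pow_mul j q)).mul_left (zeta ^ (j * s))).congr_fun fun i => ?_
  have h1 : ∀ j, zeta ^ (j * s) * (a i * (zeta ^ j * q) ^ e i) =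
      zeta ^ (j * (s + e i)) * (a i * q ^ e i) := fun j => by
    rw [mul_pow, ← pow_mul, mul_add, pow_add]
    ring
  simp only [h1, ← sum_mul, sum_zeta_pow, ite_mul, zero_mul]

/-! ### Cancellation in the Lambert series -/

/-- Exponents of the terms of nonnegative index in the Lambert series. -/
def lambertExp (c : ℕ) (m : ℕ × ℕ) : ℕ := 5 * m.1 + (10 * m.1 + c) * m.2

/-- Exponents of the terms of negative index in the Lambert series. -/
def lambertExpNeg (c : ℕ) (m : ℕ × ℕ) : ℕ := 5 * m.1 + (5 - c) + (10 * m.1 + (10 - c)) * m.2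

lemma summable_pow_of_add_le {e : ℕ × ℕ → ℕ} (he : ∀ m, m.1 + m.2 ≤ e m) {q : ℂ} (hq : ‖q‖ < 1) :
    Summable fun m => q ^ e m := by
  have h := summable_geometric_of_lt_one (norm_nonneg q) hq
  refine Summable.of_norm_bounded (h.mul_of_nonneg h (fun _ => by positivity) fun _ => by positivity)
    fun m => ?_
  rw [norm_pow, ← pow_add]
  exact pow_le_pow_of_le_one (norm_nonneg q) hq.le (he m)

lemma add_le_lambertExp {c : ℕ} (hc : 0 < c) (m : ℕ × ℕ) : m.1 + m.2 ≤ lambertExp c m := by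
  unfold lambertExp; nlinarith [Nat.zero_le (m.1 * m.2), Nat.mul_le_mul_right m.2 hc]

lemma add_le_lambertExpNeg {c : ℕ} (hc : c < 5) (m : ℕ × ℕ) : m.1 + m.2 ≤ lambertExpNeg c m := by
  unfold lambertExpNeg
  have : 1 * m.2 ≤ (10 * m.1 + (10 - c)) * m.2 := Nat.mul_le_mul_right _ (by omega)
  omega

lemma one_sub_pow_ne_zero {q : ℂ} (hq : ‖q‖ < 1) {n : ℕ} (hn : n ≠ 0) : 1 - q ^ n ≠ 0 := by
  refine sub_ne_zero.2 fun h => ?_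
  have h1 := norm_pow_lt_one hq hn
  rw [← h, norm_one] at h1
  exact lt_irrefl _ h1

/-- Numerator and denominator are multiplied by -q^(10(n+1)-c), which makes all exponents positive
and allows a geometric expansion. -/
lemma lambert_term_neg {c : ℕ} (hc : c < 5) {q : ℂ} (hq0 : q ≠ 0) (hq : ‖q‖ < 1) (n : ℕ) :
    (q ^ 5) ^ (-((n : ℤ) + 1)) / (1 - q ^ c * (q ^ 10) ^ (-((n : ℤ) + 1))) =
      -(q ^ (5 * n + (5 - c))) * (1 - q ^ (10 * n + (10 - c)))⁻¹ := by
  have h5 : 1 - q ^ (10 * n + (10 - c)) ≠ 0 := one_sub_pow_ne_zero hq (by omega)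
  have h6 : (q ^ 10) ^ (n + 1) = q ^ (10 * n + (10 - c)) * q ^ c := by
    rw [← pow_mul, ← pow_add]; congr 1; omega
  have h7 : (q ^ 10) ^ (n + 1) = q ^ (5 * n + (5 - c)) * q ^ c * (q ^ 5) ^ (n + 1) := by
    rw [← pow_mul, ← pow_mul, ← pow_add, ← pow_add]; congr 1; omega
  rw [show -((n : ℤ) + 1) = -((n + 1 : ℕ) : ℤ) by push_cast; ring, zpow_neg, zpow_neg,
    zpow_natCast, zpow_natCast]
  have hA : (q ^ 10) ^ (n + 1) ≠ 0 := pow_ne_zero _ (pow_ne_zero _ hq0)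
  have hB : (q ^ 5) ^ (n + 1) ≠ 0 := pow_ne_zero _ (pow_ne_zero _ hq0)
  have hC : q ^ c ≠ 0 := pow_ne_zero _ hq0
  generalize (q ^ 10) ^ (n + 1) = A at *
  generalize (q ^ 5) ^ (n + 1) = B at *
  generalize q ^ c = C at *
  generalize q ^ (10 * n + (10 - c)) = D at *
  generalize q ^ (5 * n + (5 - c)) = G at *
  have hd : 1 - C * A⁻¹ = -(1 - D) * (C * A⁻¹) := by
    field_simp
    linear_combination h6
  have hA' : -(1 - D) * (C * A⁻¹) ≠ 0 :=
    mul_ne_zero (neg_ne_zero.2 h5) (mul_ne_zero hC (inv_ne_zero hA))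
  rw [hd, div_eq_iff hA']
  field_simp
  linear_combination h7

lemma tsum_int_eq_add {f : ℤ → ℂ} (hf : Summable f) :
    ∑' k, f k = ∑' n : ℕ, f n + ∑' n : ℕ, f (-((n : ℤ) + 1)) := by
  have hinj : Function.Injective fun n : ℕ => -((n : ℤ) + 1) := fun a b h => by
    simp only at h; omega
  exact tsum_of_nat_of_neg_add_one (hf.comp_injective Nat.cast_injective) (hf.comp_injective hinj)

lemma tsum_eq_lambert {c : ℕ} (hc0 : 0 < c) (hc : c < 5) {q : ℂ} (hq0 : q ≠ 0) (hq : ‖q‖ < 1) :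
    ∑' k : ℤ, (q ^ 5) ^ k / (1 - q ^ c * (q ^ 10) ^ k) =
      ∑' m, q ^ lambertExp c m - ∑' m, q ^ lambertExpNeg c m := by
  have hs : Summable fun k : ℤ => (q ^ 5) ^ k / (1 - q ^ c * (q ^ 10) ^ k) := by
    refine (summable_kronecker (pow_ne_zero c hq0) (pow_ne_zero 10 hq0)
      (norm_pow_lt_one hq (by norm_num)) (norm_pow_lt_one hq (by norm_num)) ?_).of_norm
    rw [norm_pow, norm_pow]
    exact pow_lt_pow_right_of_lt_one₀ (norm_pos_iff.2 hq0) hq (by norm_num)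
  have hpos : ∑' n : ℕ, (q ^ 5) ^ (n : ℤ) / (1 - q ^ c * (q ^ 10) ^ (n : ℤ)) =
      ∑' m, q ^ lambertExp c m := by
    rw [(summable_pow_of_add_le (add_le_lambertExp hc0) hq).tsum_prod]
    refine tsum_congr fun n => ?_
    have h3 : ‖q ^ (10 * n + c)‖ < 1 := norm_pow_lt_one hq (by omega)
    rw [zpow_natCast, zpow_natCast, ← pow_mul, ← pow_mul, ← pow_add, add_comm c, div_eq_mul_inv,
      ← tsum_geometric_of_norm_lt_one h3, ← tsum_mul_left]
    refine tsum_congr fun l => ?_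
    rw [lambertExp, ← pow_mul, ← pow_add]
  have hneg : ∑' n : ℕ, (q ^ 5) ^ (-((n : ℤ) + 1)) / (1 - q ^ c * (q ^ 10) ^ (-((n : ℤ) + 1))) =
      -∑' m, q ^ lambertExpNeg c m := by
    rw [← tsum_neg, (summable_pow_of_add_le (add_le_lambertExpNeg hc) hq).neg.tsum_prod]
    refine tsum_congr fun n => ?_
    have h3 : ‖q ^ (10 * n + (10 - c))‖ < 1 := norm_pow_lt_one hq (by omega)
    rw [lambert_term_neg hc hq0 hq, ← tsum_geometric_of_norm_lt_one h3, ← tsum_mul_left]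
    refine tsum_congr fun l => ?_
    rw [lambertExpNeg, ← pow_mul, neg_mul, ← pow_add]
  rw [tsum_int_eq_add hs, hpos, hneg, sub_eq_add_neg]

/-- `e₁` and `e₂` cover the terms of the chosen class in the two halves by one index set with equal
exponents, so the halves cancel. -/
lemma rootSum_lambert_eq {c s : ℕ} (hc0 : 0 < c) (hc : c < 5) {q : ℂ} (hq : ‖q‖ < 1)
    {e₁ e₂ : ℕ × ℕ → ℕ × ℕ} (h₁ : Function.Injective e₁) (h₂ : Function.Injective e₂)
    (heq : ∀ m, lambertExp c (e₁ m) = lambertExpNeg c (e₂ m))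
    (hr₁ : ∀ m, 10 ∣ s + lambertExp c m → m ∈ Set.range e₁)
    (hr₂ : ∀ m, 10 ∣ s + lambertExpNeg c m → m ∈ Set.range e₂) :
    rootSum s (fun w => ∑' m, w ^ lambertExp c m - ∑' m, w ^ lambertExpNeg c m) q = 0 := by
  have hA := hasSum_rootSum (a := fun _ => 1) (e := lambertExp c) (q := q)
    (f := fun w => ∑' m, w ^ lambertExp c m) (fun w hw => by
      simpa using (summable_pow_of_add_le (add_le_lambertExp hc0) (hw ▸ hq)).hasSum) s
  have hB := hasSum_rootSum (a := fun _ => 1) (e := lambertExpNeg c) (q := q)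
    (f := fun w => ∑' m, w ^ lambertExpNeg c m) (fun w hw => by
      simpa using (summable_pow_of_add_le (add_le_lambertExpNeg hc) (hw ▸ hq)).hasSum) s
  rw [← h₁.hasSum_iff fun m hm => if_neg fun h => hm (hr₁ m h)] at hA
  rw [← h₂.hasSum_iff fun m hm => if_neg fun h => hm (hr₂ m h)] at hB
  have hAB := hA.unique (hB.congr_fun fun m => by simp only [Function.comp, heq])
  simp only [rootSum] at hAB ⊢
  simp only [mul_sub, sum_sub_distrib, hAB, sub_self]

lemma rootSum_lambert_two {q : ℂ} (hq : ‖q‖ < 1) :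
    rootSum 2 (fun w => ∑' m, w ^ lambertExp 2 m - ∑' m, w ^ lambertExpNeg 2 m) q = 0 := by
  -- For m = (a, b) both exponents e satisfy e + 1 = (10a + 1)(10b + 9), with the roles of the two
  -- factors exchanged.
  refine rootSum_lambert_eq (by norm_num) (by norm_num) hq (e₁ := fun m => (2 * m.1, 5 * m.2 + 4))
    (e₂ := fun m => (2 * m.2 + 1, 5 * m.1)) ?_ ?_ ?_ ?_ ?_
  · rintro ⟨a, b⟩ ⟨a', b'⟩ h
    simp only [Prod.mk.injEq] at h ⊢
    omega
  · rintro ⟨a, b⟩ ⟨a', b'⟩ h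
    simp only [Prod.mk.injEq] at h ⊢
    omega
  · rintro ⟨a, b⟩
    simp only [lambertExp, lambertExpNeg]
    ring
  · rintro ⟨n, l⟩ h
    simp only [lambertExp, add_mul, mul_assoc] at h
    exact ⟨(n / 2, l / 5), by simp only [Prod.mk.injEq]; omega⟩
  · rintro ⟨n, l⟩ h
    simp only [lambertExpNeg, add_mul, mul_assoc] at h
    exact ⟨(l / 5, n / 2), by simp only [Prod.mk.injEq]; omega⟩

lemma rootSum_lambert_four {q : ℂ} (hq : ‖q‖ < 1) :
    rootSum 1 (fun w => ∑' m, w ^ lambertExp 4 m - ∑' m, w ^ lambertExpNeg 4 m) q = 0 := by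
  refine rootSum_lambert_eq (by norm_num) (by norm_num) hq
    -- For m = (a, b) both exponents e satisfy e + 2 = (10a + 7)(10b + 3), again with the factors
    -- exchanged.
    (e₁ := fun m => (2 * m.1 + 1, 5 * m.2 + 1))
    (e₂ := fun m => (2 * m.2, 5 * m.1 + 3)) ?_ ?_ ?_ ?_ ?_
  · rintro ⟨a, b⟩ ⟨a', b'⟩ h
    simp only [Prod.mk.injEq] at h ⊢
    omega
  · rintro ⟨a, b⟩ ⟨a', b'⟩ h
    simp only [Prod.mk.injEq] at h ⊢
    omega
  · rintro ⟨a, b⟩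
    simp only [lambertExp, lambertExpNeg]
    ring
  · rintro ⟨n, l⟩ h
    simp only [lambertExp, add_mul, mul_assoc] at h
    exact ⟨(n / 2, l / 5), by simp only [Prod.mk.injEq]; omega⟩
  · rintro ⟨n, l⟩ h
    simp only [lambertExpNeg, add_mul, mul_assoc] at h
    exact ⟨(l / 5, n / 2), by simp only [Prod.mk.injEq]; omega⟩

/-! ### Vanishing components and conclusion -/

lemma rootSum_mul_pow_ten (s : ℕ) (f g : ℂ → ℂ) (q : ℂ) :
    rootSum s (fun w => f w * g (w ^ 10)) q = rootSum s f q * g (q ^ 10) := by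
  rw [rootSum, rootSum, sum_mul]
  refine sum_congr rfl fun j _ => ?_
  have : (zeta ^ j * q) ^ 10 = q ^ 10 := by
    rw [mul_pow, ← pow_mul, mul_comm j, pow_mul, isPrimitiveRoot_zeta.pow_eq_one, one_pow, one_mul]
  rw [this]
  ring

lemma rootSum_congr (s : ℕ) {f g : ℂ → ℂ} {q : ℂ} (h : ∀ w, ‖w‖ = ‖q‖ → f w = g w) :
    rootSum s f q = rootSum s g q :=
  sum_congr rfl fun j _ => by rw [h _ (norm_zeta_pow_mul j q)]

lemma qPoch_pow_ten_ne_zero {q : ℂ} (hq : ‖q‖ < 1) : qPoch (q ^ 10) (q ^ 10) ^ 2 ≠ 0 :=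
  pow_ne_zero 2 (qPoch_ne_zero_of_norm_lt (norm_pow_lt_one hq (by norm_num))
    (norm_pow_lt_one hq (by norm_num)))

lemma rootSum_inv_add_inv {q : ℂ} (hq0 : q ≠ 0) (hq : ‖q‖ < 1) :
    rootSum 2 (fun w => (X w)⁻¹ + (Y w)⁻¹) q = 0 := by
  refine (mul_eq_zero.1 ?_).resolve_right (qPoch_pow_ten_ne_zero hq)
  rw [← rootSum_mul_pow_ten 2 _ (fun z => qPoch z z ^ 2),
    rootSum_congr (g := fun w => 2 * (∑' m, w ^ lambertExp 2 m - ∑' m, w ^ lambertExpNeg 2 m))]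
  · have := rootSum_lambert_two hq
    simp only [rootSum] at this ⊢
    simp only [mul_left_comm _ (2 : ℂ), ← mul_sum, this, mul_zero]
  · intro w hw
    have hw0 : w ≠ 0 := norm_ne_zero_iff.1 (hw ▸ norm_ne_zero_iff.2 hq0)
    have hw1 : ‖w‖ < 1 := hw ▸ hq
    rw [inv_X_add_inv_Y hw0 hw1, tsum_eq_lambert (by norm_num) (by norm_num) hw0 hw1]

lemma rootSum_inv_sub_inv {q : ℂ} (hq0 : q ≠ 0) (hq : ‖q‖ < 1) :
    rootSum 0 (fun w => (X w)⁻¹ - (Y w)⁻¹) q = 0 := by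
  refine (mul_eq_zero.1 ?_).resolve_right (qPoch_pow_ten_ne_zero hq)
  rw [← rootSum_mul_pow_ten 0 _ (fun z => qPoch z z ^ 2),
    rootSum_congr (g := fun w => 2 * w * (∑' m, w ^ lambertExp 4 m - ∑' m, w ^ lambertExpNeg 4 m))]
  -- The prefactor w = ζ^j q supplies one power of ζ^j, turning the filter with s = 0 into the one
  -- with s = 1.
  · have := congrArg (2 * q * ·) (rootSum_lambert_four hq)
    simp only [rootSum, mul_sum, mul_zero] at this ⊢
    rw [← this]
    refine sum_congr rfl fun j _ => ?_
    ring
  · intro w hw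
    have hw0 : w ≠ 0 := norm_ne_zero_iff.1 (hw ▸ norm_ne_zero_iff.2 hq0)
    have hw1 : ‖w‖ < 1 := hw ▸ hq
    rw [inv_X_sub_inv_Y hw0 hw1, tsum_eq_lambert (by norm_num) (by norm_num) hw0 hw1]

lemma coeff_eq_zero_of_rootSum {a : ℕ → ℂ} {f : ℂ → ℂ} {s : ℕ}
    (hf : ∀ q : ℂ, ‖q‖ < 1 → HasSum (fun n => a n * q ^ n) (f q))
    (h : ∀ q : ℂ, q ≠ 0 → ‖q‖ < 1 → rootSum s f q = 0) {n : ℕ} (hn : 10 ∣ s + n) : a n = 0 := by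
  have h1 := eq_zero_of_hasSum_zero (b := fun n => if 10 ∣ s + n then 10 * a n else 0)
    (fun q hq0 hq => by
      have h2 := hasSum_rootSum (a := a) (e := fun n => n) (fun w hw => hf w (hw ▸ hq)) s
      rw [h q hq0 hq] at h2
      refine h2.congr_fun fun n => ?_
      simp only [ite_mul, zero_mul, mul_assoc]) n
  simpa [hn] using h1

theorem p5dag_ten_mul (j : ℕ) : p5dag (10 * j) = p5 (10 * j) := by
  have h := coeff_eq_zero_of_rootSum (a := fun n => (p5 n : ℂ) - p5dag n) (s := 0) (n := 10 * j)
    (fun q hq => ((hasSum_p5 hq).sub (hasSum_p5dag hq)).congr_fun fun n => sub_mul _ _ _)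
    (fun q hq0 hq => rootSum_inv_sub_inv hq0 hq) (by omega)
  exact_mod_cast (sub_eq_zero.1 h).symm

theorem p5dag_ten_mul_add_eight (j : ℕ) : p5dag (10 * j + 8) = -p5 (10 * j + 8) := by
  -- The choice s = 2 selects the exponents n with 10 ∣ 2 + n, that is, n ≡ 8 modulo 10.
  have h := coeff_eq_zero_of_rootSum (a := fun n => (p5 n : ℂ) + p5dag n) (s := 2)
    (n := 10 * j + 8)
    (fun q hq => ((hasSum_p5 hq).add (hasSum_p5dag hq)).congr_fun fun n => add_mul _ _ _)
    (fun q hq0 hq => rootSum_inv_add_inv hq0 hq) (by omega)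
  exact_mod_cast eq_neg_of_add_eq_zero_right h

lemma qCoeff_one_div_X (n : ℕ) : qCoeff (fun w => 1 / X w) n = p5 n :=
  qCoeff_eq (a := fun n => (p5 n : ℂ)) (fun q hq => by rw [one_div]; exact hasSum_p5 hq) n

lemma qCoeff_one_div_Y (n : ℕ) : qCoeff (fun w => 1 / Y w) n = p5dag n :=
  qCoeff_eq (a := fun n => (p5dag n : ℂ)) (fun q hq => by rw [one_div]; exact hasSum_p5dag hq) n

end LegendreSigned

theorem theorem2 :
    (∀ j : ℕ, LegendreSigned.p5dag (10 * j) = LegendreSigned.p5 (10 * j)) ∧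
    (∀ j : ℕ, LegendreSigned.p5dag (10 * j + 8) = -LegendreSigned.p5 (10 * j + 8)) ∧
    (∀ q : ℂ, ‖q‖ < 1 →
      LegendreSigned.X q ≠ 0 ∧ LegendreSigned.Y q ≠ 0 ∧
      HasSum (fun n : ℕ => (LegendreSigned.p5 n : ℂ) * q ^ n) (1 / LegendreSigned.X q) ∧
      HasSum (fun n : ℕ => (LegendreSigned.p5dag n : ℂ) * q ^ n) (1 / LegendreSigned.Y q) ∧
      LegendreSigned.component (fun w => 1 / LegendreSigned.Y w) 0 q =
        LegendreSigned.component (fun w => 1 / LegendreSigned.X w) 0 q ∧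
      LegendreSigned.component (fun w => 1 / LegendreSigned.Y w) 8 q =
        -LegendreSigned.component (fun w => 1 / LegendreSigned.X w) 8 q) := by
  refine ⟨LegendreSigned.p5dag_ten_mul, LegendreSigned.p5dag_ten_mul_add_eight, fun q hq =>
    ⟨LegendreSigned.X_ne_zero hq, LegendreSigned.Y_ne_zero hq, ?_, ?_, ?_, ?_⟩⟩
  · rw [one_div]
    exact LegendreSigned.hasSum_p5 hq
  · rw [one_div]
    exact LegendreSigned.hasSum_p5dag hq
  · simp only [LegendreSigned.component, LegendreSigned.qCoeff_one_div_X,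
      LegendreSigned.qCoeff_one_div_Y, add_zero, LegendreSigned.p5dag_ten_mul]
  · simp only [LegendreSigned.component, LegendreSigned.qCoeff_one_div_X,
      LegendreSigned.qCoeff_one_div_Y, LegendreSigned.p5dag_ten_mul_add_eight, Int.cast_neg,
      neg_mul, tsum_neg]
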